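/- Let $0<q<1$. Let the support $\mathcal C$ be either the ray $(0,\infty)$, with lattice $L=\{q^{i/2}: i\in\mathbb Z\}$ and $\int_{\mathcal C} f\,d_{q^{1/2}}z=(1-q^{1/2})\sum_{i\in\mathbb Z}q^{i/2}f(q^{i/2})$, or an interval with end points $a,b\in\mathbb R$, with lattice $L=\{bq^{i/2}: i\in\mathbb N\}\cup\{aq^{i/2}: i\in\mathbb N\}$ (two labelled branches, $\mathbb N\ni 0$) and $\int_{\mathcal C} f\,d_{q^{1/2}}z=(1-q^{1/2})\sum_{i\ge 0}q^{i/2}\big(bf(bq^{i/2})-af(aq^{i/2})\big)$. Let $\omega=\omega(\cdot\,;q)$ be a real weight function. Let $s$ be the skew-symmetric kernel on $L$ given on the lattice $q^{\mathbb Z/2}$ of the ray by $s(q^{i/2},q^{j/2})=(1+q^{1/2})^2\sigma(i,j)$, where $\sigma(2m+1,2l)=1$ and $\sigma(2l,2m+1)=-1$ for $m\ge l$, and $\sigma=0$ otherwise. For an interval, $s(bq^{i/2},bq^{j/2})=(1+q^{1/2})^2\sigma(i,j)$, $s(aq^{i/2},aq^{j/2})=-(1+q^{1/2})^2\sigma(i,j)$,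 and $s(aq^{i/2},bq^{j/2})=-s(bq^{j/2},aq^{i/2})$ is $(1+q^{1/2})^2$ if $i$ and $j$ are both even and $0$ otherwise. Let $$\langle\phi,\psi\rangle_{1,\omega}=\int_{\mathcal C}d_qy\int^{q^{1/2}y}d_qx\,\big(\phi(x)\psi(y)-\phi(y)\psi(x)\big)\,\omega(x;q)\,\omega(y;q),$$ where the integrals are Jackson integrals with base $q$ and the inner one starts at $0$ for the ray and at $a$ for the interval. Let $n\ge 0$. Assume that the moments $\int_{\mathcal C}x^i\omega(x;q)\,d_{q^{1/2}}x$, $0\le i\le 2n-1$, converge absolutely, and that the partition function $$\tau_{2n}=\frac1{(2n)!}\int_{\mathcal C^{2n}}\mathrm{Pf}[s(z_i,z_j)]_{i,j=1}^{2n}\prod_{1\le i<j\le 2n}(z_i-z_j)\prod_{i=1}^{2n}\omega(z_i;q)\,d_{q^{1/2}}z_i$$ is not zero. For $0\le k\le 2n$ and $z_1,\dots,z_k\in L$ let $$\rho_{2n,k}(z_1,\dots,z_k)=\frac1{(2n-k)!\,\tau_{2n}}\int_{\mathcal C^{2n-k}}\mathrm{Pf}[s(z_i,z_j)]_{i,j=1}^{2n}\prod_{1\le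 i<j\le 2n}(z_i-z_j)\prod_{i=1}^{2n}\omega(z_i;q)\prod_{i=k+1}^{2n}d_{q^{1/2}}z_i$$ be the $k$-point correlation function. Let $Q_0,\dots,Q_{2n-1}$ be monic polynomials, $\deg Q_l=l$, that are skew orthogonal: $\langle Q_{2i},Q_{2j}\rangle_{1,\omega}=\langle Q_{2i+1},Q_{2j+1}\rangle_{1,\omega}=0$ and $\langle Q_{2i},Q_{2j+1}\rangle_{1,\omega}=u_i\delta_{i,j}$ for $0\le i,j<n$. With $s_xf(x)=\int_{\mathcal C}s(z,x)f(z)\omega(z;q)\,d_{q^{1/2}}z$ put $$K_{2n}(x,y)=\sum_{i=0}^{n-1}\frac1{u_i}\big(Q_{2i}(x)Q_{2i+1}(y)-Q_{2i}(y)Q_{2i+1}(x)\big),$$ $$J_{2n}(x,y)=s_xK_{2n}(x,y),\qquad I_{2n}(x,y)=s(x,y)-s_xs_yK_{2n}(x,y),$$ $$\tilde K_{2n}(x,y)=\begin{pmatrix}K_{2n}(x,y)&J_{2n}(y,x)\\-J_{2n}(x,y)&-I_{2n}(x,y)\end{pmatrix}.$$ Then $\tilde K_{2n}$ is skew-symmetric,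 that is $\tilde K_{2n}(y,x)=-\tilde K_{2n}(x,y)^{\top}$ for all $x,y\in L$, and for all $0\le k\le 2n$ and $z_1,\dots,z_k\in L$ $$\rho_{2n,k}(z_1,\dots,z_k)=\mathrm{Pf}\big[\tilde K_{2n}(z_i,z_j)\big]_{i,j=1}^{k}\;\prod_{l=1}^k\omega(z_l;q).$$ -/

import Mathlib

/-! Discrete `q`-orthogonal ensemble with an even number of particles: Jackson integrals, the
skew kernel `s`, the skew inner product, the Pfaffian joint density, the correlation functions and
the matrix kernel built from skew orthogonal polynomials. -/

namespace QOrth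

/-- The Pfaffian of a `2m × 2m` (skew-symmetric) matrix,
`1 / (2 ^ m m!) ∑_σ sgn σ ∏_{i < m} A (σ (2i)) (σ (2i+1))` with `0`-based indices. -/
noncomputable def pfaffian (m : ℕ) (A : Matrix (Fin (2 * m)) (Fin (2 * m)) ℝ) : ℝ :=
  1 / (2 ^ m * (m.factorial : ℝ)) *
    ∑ σ : Equiv.Perm (Fin (2 * m)), ((Equiv.Perm.sign σ : ℤ) : ℝ) *
      ∏ i : Fin m, A (σ ⟨2 * i.1, by omega⟩) (σ ⟨2 * i.1 + 1, by omega⟩)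

/-- The supports: the ray `(0, ∞)`, with lattice `q ^ (ℤ / 2)`, and the intervals with end points
`a` and `b`, with lattice `b q ^ (ℕ / 2) ∪ a q ^ (ℕ / 2)`. The interval from `0` to `1` carries the
lattice `q ^ (ℕ / 2)`; its branch at the end point `a = 0` has mass zero. -/
inductive Contour : Type
  | ray : Contour
  | interval (a b : ℝ) : Contour

/-- Labels of the lattice points of a support. For `interval a b` the left summand labels the
points `b q ^ (i / 2)` and the right summand the points `a q ^ (i / 2)`. -/
abbrev Contour.Site : Contour → Type
  | .ray => ℤ
  | .interval _ _ => ℕ ⊕ ℕ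

/-- The lattice point with a given label. -/
noncomputable def point (q : ℝ) : (C : Contour) → C.Site → ℝ
  | .ray, i => √q ^ (show ℤ from i)
  | .interval _ b, .inl i => b * √q ^ i
  | .interval a _, .inr i => a * √q ^ i

/-- The mass that the Jackson integral with base `q ^ (1 / 2)` over the support (for an interval:
the integral from `0` to `b` minus the one from `0` to `a`) gives to a lattice point. -/
noncomputable def mass (q : ℝ) : (C : Contour) → C.Site → ℝ
  | .ray, i => (1 - √q) * √q ^ (show ℤ from i)
  | .interval _ b, .inl i => (1 - √q) * (b * √q ^ i)
  | .interval a _, .inr i => -((1 - √q) * (a * √q ^ i))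

/-- The sign of `s (q ^ (i / 2), q ^ (j / 2))`: it is `1` if `i = 2m + 1`, `j = 2n` with `n ≤ m`,
it is `-1` if `i = 2n`, `j = 2m + 1` with `n ≤ m`, and `0` otherwise. -/
noncomputable def halfSign (i j : ℤ) : ℝ :=
  open Classical in
  if ∃ m n : ℤ, i = 2 * m + 1 ∧ j = 2 * n ∧ n ≤ m then 1
  else if ∃ m n : ℤ, i = 2 * n ∧ j = 2 * m + 1 ∧ n ≤ m then -1
  else 0

/-- The skew-symmetric kernel `s`. On the ray, and on the branch of `b` of an interval, it is the
kernel `(1 + q ^ (1 / 2)) ^ 2 * halfSign`. The branch of the other end point `a` is run through in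
the opposite direction, and points of the two branches interact if both exponents are integers;
this is what the iterated integral from `a` to `b` and from `a` to `q ^ (1 / 2) y` amounts to. -/
noncomputable def skewKer (q : ℝ) : (C : Contour) → C.Site → C.Site → ℝ
  | .ray, i, j => (1 + √q) ^ 2 * halfSign i j
  | .interval _ _, .inl i, .inl j => (1 + √q) ^ 2 * halfSign i j
  | .interval _ _, .inr i, .inr j => -((1 + √q) ^ 2 * halfSign i j)
  | .interval _ _, .inr i, .inl j => (1 + √q) ^ 2 * (if Even i ∧ Even j then 1 else 0)
  | .interval _ _, .inl i, .inr j => -((1 + √q) ^ 2 * (if Even i ∧ Even j then 1 else 0))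

/-- The Jackson integral with base `q` from `a` to `b`. -/
noncomputable def jackson (q a b : ℝ) (f : ℝ → ℝ) : ℝ :=
  (∑' n : ℕ, (1 - q) * (b * q ^ n) * f (b * q ^ n)) -
    ∑' n : ℕ, (1 - q) * (a * q ^ n) * f (a * q ^ n)

/-- The Jackson integral with base `q` from `0` to `∞`. -/
noncomputable def jacksonRay (q : ℝ) (f : ℝ → ℝ) : ℝ :=
  ∑' n : ℤ, (1 - q) * q ^ n * f (q ^ n)

/-- The skew inner product
`⟨φ, ψ⟩ = ∫ d_q y ∫^{q ^ (1/2) y} d_q x (φ x ψ y - φ y ψ x) ω x ω y`, the outer integral being over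
the support and the inner one starting at its left end point. -/
noncomputable def skewInner (q : ℝ) (C : Contour) (ω φ ψ : ℝ → ℝ) : ℝ :=
  match C with
  | .ray => jacksonRay q fun y => jackson q 0 (√q * y) fun x =>
      (φ x * ψ y - φ y * ψ x) * ω x * ω y
  | .interval a b => jackson q a b fun y => jackson q a (√q * y) fun x =>
      (φ x * ψ y - φ y * ψ x) * ω x * ω y

/-- `Q 0, …, Q (2n - 1)` are monic skew orthogonal polynomials, `Q l` of degree `l`, and
`u 0, …, u (n - 1)` are their normalizations. -/
structure IsSkewOrthogonal (q : ℝ) (C : Contour) (ω : ℝ → ℝ) (n : ℕ)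
    (Q : ℕ → Polynomial ℝ) (u : ℕ → ℝ) : Prop where
  monic : ∀ l < 2 * n, (Q l).Monic
  natDegree_eq : ∀ l < 2 * n, (Q l).natDegree = l
  even_even : ∀ i < n, ∀ j < n,
    skewInner q C ω (fun x => (Q (2 * i)).eval x) (fun x => (Q (2 * j)).eval x) = 0
  odd_odd : ∀ i < n, ∀ j < n,
    skewInner q C ω (fun x => (Q (2 * i + 1)).eval x) (fun x => (Q (2 * j + 1)).eval x) = 0
  even_odd : ∀ i < n, ∀ j < n,
    skewInner q C ω (fun x => (Q (2 * i)).eval x) (fun x => (Q (2 * j + 1)).eval x) =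
      if i = j then u i else 0

section Ensemble

variable (q : ℝ) (C : Contour) (ω : ℝ → ℝ)

/-- The unnormalized joint density of `2n` particles,
`Pf [s (z_i, z_j)] ∏_{i < j} (z_i - z_j) ∏_i ω (z_i)`. -/
noncomputable def density (n : ℕ) (z : Fin (2 * n) → C.Site) : ℝ :=
  pfaffian n (Matrix.of fun i j => skewKer q C (z i) (z j)) *
    (∏ i, ∏ j ∈ Finset.Ioi i, (point q C (z i) - point q C (z j))) *
    ∏ i, ω (point q C (z i))

/-- The partition function `τ` of `2n` particles: the integral of the joint density over all
`2n` variables, divided by `(2n)!`. -/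
noncomputable def partitionFunction (n : ℕ) : ℝ :=
  1 / ((2 * n).factorial : ℝ) *
    ∑' w : Fin (2 * n) → C.Site, density q C ω n w * ∏ i, mass q C (w i)

/-- The `k`-point correlation function of `2n` particles: the last `2n - k` variables are
integrated out, and the result is divided by `(2n - k)! τ`. -/
noncomputable def correlation (n k : ℕ) (hk : k ≤ 2 * n) (z : Fin k → C.Site) : ℝ :=
  1 / (((2 * n - k).factorial : ℝ) * partitionFunction q C ω n) *
    ∑' w : Fin (2 * n - k) → C.Site,
      density q C ω n (Fin.append z w ∘ Fin.cast (Nat.add_sub_of_le hk).symm) *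
        ∏ i, mass q C (w i)

/-- The operator `(s f) x = ∫ s (z, x) f z ω z dz` over the support, with base `q ^ (1 / 2)`. -/
noncomputable def skewOp (f : C.Site → ℝ) (x : C.Site) : ℝ :=
  ∑' z : C.Site, skewKer q C z x * f z * ω (point q C z) * mass q C z

variable (Q : ℕ → Polynomial ℝ) (u : ℕ → ℝ) (n : ℕ)

/-- The kernel `K`. -/
noncomputable def kerK (x y : C.Site) : ℝ :=
  ∑ i ∈ Finset.range n, 1 / u i *
    ((Q (2 * i)).eval (point q C x) * (Q (2 * i + 1)).eval (point q C y) -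
      (Q (2 * i)).eval (point q C y) * (Q (2 * i + 1)).eval (point q C x))

/-- The kernel `J (x, y) = s_x K (x, y)`. -/
noncomputable def kerJ (x y : C.Site) : ℝ :=
  skewOp q C ω (fun x' => kerK q C Q u n x' y) x

/-- The kernel `I (x, y) = s (x, y) - s_x s_y K (x, y)`. -/
noncomputable def kerI (x y : C.Site) : ℝ :=
  skewKer q C x y -
    skewOp q C ω (fun x' => skewOp q C ω (fun y' => kerK q C Q u n x' y') y) x

/-- The `2 × 2` matrix kernel. -/
noncomputable def kerMat (x y : C.Site) : Matrix (Fin 2) (Fin 2) ℝ :=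
  !![kerK q C Q u n x y, kerJ q C ω Q u n y x;
     -kerJ q C ω Q u n x y, -kerI q C ω Q u n x y]

end Ensemble

/-- The `2k × 2k` matrix made of the `2 × 2` blocks `B i j`. -/
def blockMatrix {k : ℕ} (B : Fin k → Fin k → Matrix (Fin 2) (Fin 2) ℝ) :
    Matrix (Fin (2 * k)) (Fin (2 * k)) ℝ :=
  Matrix.of fun a b =>
    B ⟨a.1 / 2, by omega⟩ ⟨b.1 / 2, by omega⟩
      ⟨a.1 % 2, Nat.mod_lt _ two_pos⟩ ⟨b.1 % 2, Nat.mod_lt _ two_pos⟩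

end QOrth

namespace QOrth
open Finset

/-! The proof is de Bruijn's integration formula with some variables held fixed, followed by a Schur
complement. Since the `Q l` are monic of degree `l`, the Vandermonde product is up to sign `det
[Q_r(z_l)]`, so the density is a Pfaffian of the skew form `s` times a determinant. A Pfaffian whose
entries are double sums expands into a sum over tuples of points (`pf_hasSum`); read backwards, this
integrates Pfaffian times determinant into a single Pfaffian.

To keep `k` points unsummed, the lattice is enlarged by `k` labels and `k` partners, paired
hyperbolically (`labelForm`). The Pfaffian then vanishes unless every label is used exactly once,
and the row that uses label `i` is evaluated at the fixed point `z i`. The result is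
`tsum_pfaffian_mul_det`: up to explicit constants the correlation function is the Pfaffian of `[[S,
B], [-Bᵀ, D]]`, where `S` is `s` between fixed points, `B` collects the values `Q_r(z_i)` and the
transforms `-(s Q_r)(z_i)`, and `D` is the Gram matrix of the polynomials under the double lattice
sum against `s`.

By `hasSum_skewInner` that double sum is the iterated Jackson integral `⟨·, ·⟩`, so skew
orthogonality makes `D` a direct sum of blocks `u_i [0, 1; -1, 0]`. Eliminating `D` (`pf_schur`)
leaves `∏ u_i` times the Pfaffian of `S + B D⁻¹ Bᵀ`, which is minus the matrix kernel
(`schur_complement_eq`). The case `k = 0` gives `τ = (-1)ⁿ ∏ u_i`; its nonvanishing makes `D`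
invertible and cancels the constants. Convergence is absolute throughout, because the moments
converge absolutely and `s` is bounded. -/

/-! ### Absolutely convergent sums of products over tuples -/

theorem summable_mul_prod {α β : Type*} {f : α → ℝ} {g : β → ℝ} (hf : Summable f)
    (hg : Summable g) : Summable fun p : α × β => f p.1 * g p.2 :=
  summable_mul_of_summable_norm (summable_abs_iff.2 hf) (summable_abs_iff.2 hg)

theorem hasSum_fin_prod {Y : Type*} {N : ℕ} (f : Fin N → Y → ℝ) (a : Fin N → ℝ)
    (h : ∀ i, HasSum (f i) (a i)) : HasSum (fun g : Fin N → Y => ∏ i, f i (g i)) (∏ i, a i) := by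
  induction N with
  | zero =>
    simp only [univ_eq_empty, prod_empty]
    exact hasSum_unique fun _ : Fin 0 → Y => (1 : ℝ)
  | succ N ih =>
    have ih := ih (fun i => f i.succ) (fun i => a i.succ) fun i => h i.succ
    have hs := summable_mul_prod (h 0).summable ih.summable
    have hp := HasSum.mul (h 0) ih hs
    rw [← (Fin.consEquiv fun _ => Y).hasSum_iff]
    have he : (fun g : Fin (N + 1) → Y => ∏ i, f i (g i)) ∘ Fin.consEquiv (fun _ => Y) =
        fun p => f 0 p.1 * ∏ i : Fin N, f i.succ (p.2 i) := by
      funext p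
      rw [Function.comp_apply, Fin.prod_univ_succ]
      rfl
    rw [he, Fin.prod_univ_succ]
    exact hp

theorem hasSum_pi_prod {Y ι : Type*} [Fintype ι] (f : ι → Y → ℝ) (a : ι → ℝ)
    (h : ∀ i, HasSum (f i) (a i)) : HasSum (fun g : ι → Y => ∏ i, f i (g i)) (∏ i, a i) := by
  have e := (Fintype.equivFin ι).symm
  have h1 := hasSum_fin_prod (fun i => f (e i)) (fun i => a (e i)) fun i => h (e i)
  rw [e.prod_comp] at h1
  rw [← (e.arrowCongr (Equiv.refl Y)).hasSum_iff]
  have he : (fun g : ι → Y => ∏ i, f i (g i)) ∘ e.arrowCongr (Equiv.refl Y) =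
      fun g => ∏ i, f (e i) (g i) := by
    funext g
    rw [Function.comp_apply, ← Equiv.prod_comp e]
    simp
  rw [he]
  exact h1

/-- The Pfaffian of a matrix whose index set is split into ordered pairs by `e`. -/
noncomputable def pf {κ ι : Type*} [Fintype κ] [Fintype ι] [DecidableEq ι]
    (e : κ × Fin 2 ≃ ι) (A : Matrix ι ι ℝ) : ℝ :=
  1 / (2 ^ Fintype.card κ * ((Fintype.card κ).factorial : ℝ)) *
    ∑ σ : Equiv.Perm ι, ((Equiv.Perm.sign σ : ℤ) : ℝ) *
      ∏ i : κ, A (σ (e (i, 0))) (σ (e (i, 1)))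

/-- A tuple indexed by `ι` is one element of `Y × Y` for each pair, and the summand is a product
over the pairs, so the sum factorizes. -/
theorem hasSum_pairs {κ ι Y : Type*} [Fintype κ] [Fintype ι] (e : κ × Fin 2 ≃ ι)
    (Φ : ι → Y → ℝ) (B : Y → Y → ℝ) (A : Matrix ι ι ℝ)
    (h : ∀ r r', HasSum (fun p : Y × Y => Φ r p.1 * Φ r' p.2 * B p.1 p.2) (A r r')) :
    HasSum (fun f : ι → Y => (∏ r, Φ r (f r)) * ∏ i, B (f (e (i, 0))) (f (e (i, 1))))
      (∏ i, A (e (i, 0)) (e (i, 1))) := by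
  have h1 := hasSum_pi_prod _ _ fun i : κ => h (e (i, 0)) (e (i, 1))
  let E : (ι → Y) ≃ (κ → Y × Y) :=
    ((e.symm.arrowCongr (Equiv.refl Y)).trans (Equiv.curry κ (Fin 2) Y)).trans
      ((Equiv.refl κ).arrowCongr (finTwoArrowEquiv Y))
  rw [← E.hasSum_iff] at h1
  convert h1 using 2 with f
  rw [← e.prod_comp, Fintype.prod_prod_type, ← prod_mul_distrib]
  refine prod_congr rfl fun i _ => ?_
  simp [E, Function.curry]

/-! ### Multilinear expansion and transformation of Pfaffians -/

section Pfaffian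

variable {κ ι : Type*} [Fintype κ] [Fintype ι] [DecidableEq ι] (e : κ × Fin 2 ≃ ι)

/-- The term of `σ` in the Pfaffian is the product over the pairing `e.trans σ`, to which
`hasSum_pairs` applies. With `Y = ι` this yields the congruence formula, with `Y` the set of labels
de Bruijn's formula. -/
theorem pf_hasSum {Y : Type*} (Φ : ι → Y → ℝ) (B : Y → Y → ℝ) (A : Matrix ι ι ℝ)
    (h : ∀ r r', HasSum (fun p : Y × Y => Φ r p.1 * Φ r' p.2 * B p.1 p.2) (A r r')) :
    HasSum (fun f : ι → Y => (∏ r, Φ r (f r)) * pf e (Matrix.of fun r r' => B (f r) (f r')))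
      (pf e A) := by
  unfold pf
  have h1 := (hasSum_sum (s := univ) fun (σ : Equiv.Perm ι) _ =>
    (hasSum_pairs (e.trans σ) Φ B A h).mul_left ((Equiv.Perm.sign σ : ℤ) : ℝ)).mul_left
      (1 / (2 ^ Fintype.card κ * ((Fintype.card κ).factorial : ℝ)))
  refine (congrArg (fun F => HasSum F _) (funext fun f => ?_)).mp h1
  simp only [mul_sum]
  refine sum_congr rfl fun σ _ => ?_
  simp only [Matrix.of_apply, Equiv.trans_apply]
  ring

theorem pf_submatrix_equiv {ι' : Type*} [Fintype ι'] [DecidableEq ι'] (f : ι ≃ ι')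
    (A : Matrix ι' ι' ℝ) : pf e (A.submatrix f f) = pf (e.trans f) A := by
  unfold pf
  congr 1
  rw [← Equiv.sum_comp (Equiv.permCongr f)]
  refine sum_congr rfl fun σ _ => ?_
  simp [Equiv.Perm.sign_permCongr]

theorem pf_submatrix_perm (τ : Equiv.Perm ι) (A : Matrix ι ι ℝ) :
    pf e (A.submatrix τ τ) = ((Equiv.Perm.sign τ : ℤ) : ℝ) * pf e A := by
  unfold pf
  rw [mul_left_comm]
  congr 1
  rw [mul_sum, ← Equiv.sum_comp (Equiv.mulLeft τ⁻¹)]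
  refine sum_congr rfl fun σ _ => ?_
  simp [mul_assoc]

theorem pf_congr_pairs {κ' : Type*} [Fintype κ'] (g : κ' ≃ κ) (A : Matrix ι ι ℝ) :
    pf ((g.prodCongr (Equiv.refl (Fin 2))).trans e) A = pf e A := by
  unfold pf
  rw [Fintype.card_congr g]
  congr 1
  refine sum_congr rfl fun σ _ => ?_
  congr 1
  rw [← g.prod_comp]
  simp

/-- Transposing two indices with the same image fixes the matrix and reverses the sign of the
Pfaffian. Skew symmetry is not needed, as the sum runs over all permutations. -/
theorem pf_submatrix_eq_zero {Y : Type*} (B : Matrix Y Y ℝ) (f : ι → Y)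
    (hf : ¬ Function.Injective f) : pf e (B.submatrix f f) = 0 := by
  simp only [Function.Injective, not_forall] at hf
  obtain ⟨a, b, hab, hne⟩ := hf
  have h := pf_submatrix_perm e (Equiv.swap a b) (B.submatrix f f)
  have h2 : f ∘ Equiv.swap a b = f := by
    funext x
    rcases eq_or_ne x a with rfl | hxa
    · simp [hab]
    rcases eq_or_ne x b with rfl | hxb
    · simp [hab]
    · simp [Equiv.swap_apply_of_ne_of_ne hxa hxb]
  rw [Matrix.submatrix_submatrix, h2, Equiv.Perm.sign_swap hne] at h
  simp at h
  linarith

theorem pf_eq_zero_of_row (A : Matrix ι ι ℝ) (hA : ∀ r r', A r r' = -A r' r) (r : ι)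
    (hr : ∀ r', A r r' = 0) : pf e A = 0 := by
  unfold pf
  rw [sum_eq_zero, mul_zero]
  intro σ _
  obtain ⟨⟨i, b⟩, hi⟩ := (e.trans σ).surjective r
  rw [prod_eq_zero (mem_univ i), mul_zero]
  simp only [Equiv.trans_apply] at hi
  fin_cases b
  · simp only [Fin.zero_eta] at hi
    rw [hi, hr]
  · simp only [Fin.mk_one] at hi
    rw [hA, hi, hr, neg_zero]

theorem pf_smul (c : ℝ) (A : Matrix ι ι ℝ) : pf e (c • A) = c ^ Fintype.card κ * pf e A := by
  unfold pf
  simp only [mul_sum]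
  refine sum_congr rfl fun σ _ => ?_
  simp [prod_mul_distrib]
  ring

/-- The entries of `P A Pᵀ` are double sums, so the Pfaffian expands over maps `ι → ι`.
Non-injective maps contribute zero, and a permutation contributes its sign; what remains is the
Leibniz formula for `det P`. -/
theorem pf_mul_mul_transpose (P A : Matrix ι ι ℝ) : pf e (P * A * P.transpose) = P.det * pf e A := by
  have h := (pf_hasSum e (fun r s => P r s) A (P * A * P.transpose) fun r r' => by
    refine (congrArg (HasSum _) ?_).mp (hasSum_fintype _)
    rw [Fintype.sum_prod_type, sum_comm]
    simp only [Matrix.mul_apply, Matrix.transpose_apply, sum_mul]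
    refine sum_congr rfl fun x _ => sum_congr rfl fun y _ => ?_
    ring).tsum_eq
  rw [← h, tsum_fintype, Matrix.det_apply', sum_mul]
  have hz : ∀ f : ι → ι, ¬ Function.Injective f →
      (∏ r, P r (f r)) * pf e (Matrix.of fun r r' => A (f r) (f r')) = 0 := fun f hf => by
    have := pf_submatrix_eq_zero e A f hf
    change _ * pf e (A.submatrix f f) = 0
    rw [this, mul_zero]
  symm
  have hdet : ∀ σ : Equiv.Perm ι, ((Equiv.Perm.sign σ : ℤ) : ℝ) * (∏ i, P (σ i) i) * pf e A =
      (fun f : ι → ι => (∏ r, P r (f r)) * pf e (Matrix.of fun r r' => A (f r) (f r'))) (σ⁻¹ : Equiv.Perm ι) := by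
    intro σ
    have := pf_submatrix_perm e σ⁻¹ A
    change _ = _ * pf e (A.submatrix (σ⁻¹ : Equiv.Perm ι) (σ⁻¹ : Equiv.Perm ι))
    rw [this, ← Equiv.prod_comp σ fun r => P r ((σ⁻¹ : Equiv.Perm ι) r)]
    simp
    ring
  rw [sum_congr rfl fun σ _ => hdet σ]
  refine (Equiv.sum_comp (Equiv.inv (Equiv.Perm ι))
    fun σ : Equiv.Perm ι => (fun f : ι → ι => (∏ r, P r (f r)) * pf e (Matrix.of fun r r' => A (f r) (f r'))) σ).trans ?_
  refine sum_of_injOn (fun σ : Equiv.Perm ι => (σ : ι → ι)) (fun σ _ τ _ h => Equiv.coe_fn_injective h)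
    (fun _ _ => mem_coe.2 (mem_univ _)) (fun f _ hf => hz f fun hinj => hf ?_) fun _ _ => rfl
  exact ⟨Equiv.ofBijective f (Finite.injective_iff_bijective.1 hinj), by simp, rfl⟩

end Pfaffian
-- Pfaffians of block diagonal matrices
section Blocks

variable {κ ι : Type*} [Fintype κ] [Fintype ι] [DecidableEq ι]

/-- The summand of a permutation in the Pfaffian. -/
noncomputable def pfTerm (e : κ × Fin 2 ≃ ι) (A : Matrix ι ι ℝ) (σ : Equiv.Perm ι) : ℝ :=
  ((Equiv.Perm.sign σ : ℤ) : ℝ) * ∏ i : κ, A (σ (e (i, 0))) (σ (e (i, 1)))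

/-- A permutation of the pairs acts once on first and once on second members, hence is even, and it
only reorders the factors. -/
theorem pfTerm_swap_pairs [DecidableEq κ] (e : κ × Fin 2 ≃ ι) (A : Matrix ι ι ℝ) (π : Equiv.Perm κ)
    (σ : Equiv.Perm ι) :
    pfTerm e A (σ * e.permCongr (Equiv.prodCongrLeft fun _ => π)) = pfTerm e A σ := by
  unfold pfTerm
  have hs : Equiv.Perm.sign (e.permCongr (Equiv.prodCongrLeft fun _ : Fin 2 => π)) = 1 := by
    rw [Equiv.Perm.sign_permCongr, Equiv.Perm.sign_prodCongrLeft]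
    simp
  rw [Equiv.Perm.sign_mul, hs, mul_one]
  congr 1
  rw [← Equiv.prod_comp π fun i => A (σ (e (i, 0))) (σ (e (i, 1)))]
  simp [Equiv.permCongr_apply]

/-- Reversing a pair changes both the sign of the permutation and, by skew symmetry, that of the
matrix entry. -/
theorem pfTerm_swap_in_pairs [DecidableEq κ] (e : κ × Fin 2 ≃ ι) (A : Matrix ι ι ℝ)
    (hA : ∀ r r', A r r' = -A r' r) (ε : κ → Equiv.Perm (Fin 2)) (σ : Equiv.Perm ι) :
    pfTerm e A (σ * e.permCongr (Equiv.prodCongrRight ε)) = pfTerm e A σ := by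
  unfold pfTerm
  have h2 : ∀ i, A (σ (e (i, ε i 0))) (σ (e (i, ε i 1))) =
      ((Equiv.Perm.sign (ε i) : ℤ) : ℝ) * A (σ (e (i, 0))) (σ (e (i, 1))) := by
    intro i
    generalize ε i = δ
    obtain h | h : δ = 1 ∨ δ = Equiv.swap 0 1 := by revert δ; decide
    · simp [h]
    · rw [h, Equiv.swap_apply_left, Equiv.swap_apply_right, Equiv.Perm.sign_swap (by decide), hA]
      simp
  have hs : ∀ i, ((Equiv.Perm.sign (ε i) : ℤ) : ℝ) * ((Equiv.Perm.sign (ε i) : ℤ) : ℝ) = 1 :=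
    fun i => by exact_mod_cast Int.units_coe_mul_self _
  simp only [Equiv.Perm.mul_apply, Equiv.permCongr_apply, Equiv.symm_apply_apply,
    Equiv.prodCongrRight_apply, h2, prod_mul_distrib, Equiv.Perm.sign_mul,
    Equiv.Perm.sign_permCongr, Equiv.Perm.sign_prodCongrRight]
  push_cast [Units.coe_prod]
  rw [mul_assoc, ← mul_assoc (∏ i, _) (∏ i, _), ← prod_mul_distrib, prod_congr rfl fun i _ => hs i]
  simp

theorem exists_perm_pfTerm [DecidableEq κ] (e : κ × Fin 2 ≃ ι) (A : Matrix ι ι ℝ)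
    (hA : ∀ r r', A r r' = -A r' r) (r r' : ι) :
    ∃ τ : Equiv.Perm ι, τ r = r' ∧ ∀ σ, pfTerm e A (σ * τ) = pfTerm e A σ := by
  obtain ⟨⟨i, b⟩, rfl⟩ := e.surjective r
  obtain ⟨⟨j, c⟩, rfl⟩ := e.surjective r'
  refine ⟨e.permCongr (Equiv.prodCongrLeft fun _ => Equiv.swap i j) *
    e.permCongr (Equiv.prodCongrRight fun _ => Equiv.swap b c), ?_, fun σ => ?_⟩
  · simp [Equiv.permCongr_apply]
  · rw [← mul_assoc, pfTerm_swap_in_pairs e A hA, pfTerm_swap_pairs]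

/-- The symmetries of the summand are transitive on the indices, so the permutations with `σ l = r`
contribute equally for every `l`. This replaces the expansion along a row: it suffices to sum over
the stabilizer of one index. -/
theorem sum_pfTerm_eq [DecidableEq κ] (e : κ × Fin 2 ≃ ι) (A : Matrix ι ι ℝ)
    (hA : ∀ r r', A r r' = -A r' r) (r : ι) :
    ∑ σ, pfTerm e A σ = Fintype.card ι * ∑ σ with σ r = r, pfTerm e A σ := by
  have h1 : ∀ σ : Equiv.Perm ι, pfTerm e A σ = ∑ l, if σ l = r then pfTerm e A σ else 0 := by
    intro σ
    rw [sum_eq_single (σ⁻¹ r)]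
    · simp
    · rintro b - hb
      rw [if_neg]
      rintro rfl
      simp at hb
    · simp
  rw [sum_congr rfl fun σ _ => h1 σ, sum_comm]
  rw [sum_congr rfl (g := fun _ => ∑ σ with σ r = r, pfTerm e A σ), sum_const, nsmul_eq_mul, card_univ]
  intro l _
  obtain ⟨τ, hτ, hinv⟩ := exists_perm_pfTerm e A hA r l
  rw [sum_filter, ← Equiv.sum_comp (Equiv.mulRight τ⁻¹)]
  refine sum_congr rfl fun σ _ => ?_
  have h3 : τ⁻¹ l = r := by rw [← hτ]; simp
  have h4 := hinv (σ * τ⁻¹)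
  rw [inv_mul_cancel_right] at h4
  simp only [Equiv.coe_mulRight, Equiv.Perm.mul_apply, h3, h4]

/-- The pairing of a disjoint union. -/
def sumPairs {κ₁ κ₂ ι₁ ι₂ : Type*} (e₁ : κ₁ × Fin 2 ≃ ι₁) (e₂ : κ₂ × Fin 2 ≃ ι₂) :
    (κ₁ ⊕ κ₂) × Fin 2 ≃ ι₁ ⊕ ι₂ :=
  (Equiv.sumProdDistrib κ₁ κ₂ (Fin 2)).trans (e₁.sumCongr e₂)

/-- The direct sum of the matrices `v i • [0, 1; -1, 0]`. -/
def sympl {κ : Type*} [DecidableEq κ] (v : κ → ℝ) : Matrix (κ × Fin 2) (κ × Fin 2) ℝ :=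
  Matrix.of fun p q => if p.1 = q.1 then v p.1 * !![0, 1; -1, 0] p.2 q.2 else 0

theorem sympl_skew {κ : Type*} [DecidableEq κ] (v : κ → ℝ) (p q : κ × Fin 2) :
    sympl v p q = -sympl v q p := by
  obtain ⟨i, b⟩ := p
  obtain ⟨j, c⟩ := q
  by_cases h : i = j
  · subst h
    fin_cases b <;> fin_cases c <;> simp [sympl]
  · simp [sympl, h, Ne.symm h]

/-- It suffices to consider permutations fixing the second index of the new pair. The entry of that
pair then lies in a column whose only nonzero entry is `u`, so the first index is fixed too and a
permutation of `ι` remains. The number of indices, `2 (m + 1)` for `m` old pairs, accounts for the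
change of normalization. -/
theorem pf_fromBlocks_one [DecidableEq κ] (e : κ × Fin 2 ≃ ι) (A : Matrix ι ι ℝ)
    (hA : ∀ r r', A r r' = -A r' r) (u : ℝ) :
    pf (sumPairs e (Equiv.refl (Fin 1 × Fin 2)))
      (Matrix.fromBlocks A 0 0 (sympl fun _ : Fin 1 => u)) = u * pf e A := by
  set E := sumPairs e (Equiv.refl (Fin 1 × Fin 2)) with hE
  set M := Matrix.fromBlocks A 0 0 (sympl fun _ : Fin 1 => u) with hM
  have hskew : ∀ r r', M r r' = -M r' r := by
    rintro (r | r) (r' | r')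
    · exact hA r r'
    · simp [hM]
    · simp [hM]
    · exact sympl_skew (fun _ => u) r r'
  have hpair : ∀ b : Fin 2, E (Sum.inr 0, b) = Sum.inr (0, b) := fun b => rfl
  have hpair' : ∀ i b, E (Sum.inl i, b) = Sum.inl (e (i, b)) := fun i b => rfl
  have key : ∑ σ with σ (Sum.inr (0, 1)) = Sum.inr (0, 1), pfTerm E M σ =
      u * ∑ σ, pfTerm e A σ := by
    rw [mul_sum]
    symm
    refine sum_of_injOn (fun σ : Equiv.Perm ι => σ.sumCongr (1 : Equiv.Perm (Fin 1 × Fin 2)))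
      ?_ ?_ ?_ ?_
    · intro σ _ τ _ h
      ext x
      simpa using congrArg (fun f : Equiv.Perm (ι ⊕ Fin 1 × Fin 2) => f (Sum.inl x)) h
    · intro σ _
      simp
    · intro σ hσ hn
      simp only [mem_filter, mem_univ, true_and] at hσ
      by_cases h0 : σ (Sum.inr (0, 0)) = Sum.inr (0, 0)
      · exfalso
        have hfix : ∀ x, σ (Sum.inr x) = Sum.inr x := by
          rintro ⟨a, b⟩
          fin_cases a
          fin_cases b
          · exact h0
          · exact hσ
        have hmaps : Set.MapsTo σ (Set.range Sum.inl) (Set.range Sum.inl) := by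
          rintro _ ⟨a, rfl⟩
          rcases hx : σ (Sum.inl a) with x | x
          · exact ⟨x, rfl⟩
          · rw [← hfix x] at hx
            simpa using σ.injective hx
        obtain ⟨⟨σa, σb⟩, rfl⟩ := Equiv.Perm.mem_sumCongrHom_range_of_perm_mapsTo_inl hmaps
        apply hn
        refine ⟨σa, by simp, ?_⟩
        ext (x | x)
        · simp
        · have := hfix x
          simpa using this.symm
      · unfold pfTerm
        rw [prod_eq_zero (mem_univ (Sum.inr 0)), mul_zero]
        rw [hpair, hpair, hσ]
        rcases hx : σ (Sum.inr (0, 0)) with x | ⟨a, b⟩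
        · simp [hM]
        · fin_cases a
          fin_cases b
          · exact absurd hx h0
          · simp [hM, sympl]
    · intro σ _
      unfold pfTerm
      rw [Equiv.Perm.sign_sumCongr, Fintype.prod_sum_type]
      simp only [hpair', Finset.univ_unique, Fin.default_eq_zero, prod_singleton, hpair]
      simp [hM, sympl]
      ring
  have hcard : Fintype.card (ι ⊕ Fin 1 × Fin 2) = 2 * (Fintype.card κ + 1) := by
    rw [← Fintype.card_congr E]
    simp
    ring
  change 1 / _ * ∑ σ, pfTerm E M σ = u * (1 / _ * ∑ σ, pfTerm e A σ)
  rw [sum_pfTerm_eq E M hskew (Sum.inr (0, 1)), key, hcard, Fintype.card_sum, Fintype.card_fin,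
    Nat.factorial_succ, pow_succ]
  have := Nat.factorial_ne_zero (Fintype.card κ)
  push_cast
  field_simp

theorem pf_fromBlocks_sympl [DecidableEq κ] (e : κ × Fin 2 ≃ ι) (A : Matrix ι ι ℝ)
    (hA : ∀ r r', A r r' = -A r' r) {n : ℕ} (v : Fin n → ℝ) :
    pf (sumPairs e (Equiv.refl (Fin n × Fin 2)))
      (Matrix.fromBlocks A 0 0 (sympl v)) = (∏ i, v i) * pf e A := by
  induction n with
  | zero =>
    have h := pf_congr_pairs (sumPairs e (Equiv.refl (Fin 0 × Fin 2))) (Equiv.sumEmpty κ (Fin 0)).symm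
      (Matrix.fromBlocks A 0 0 (sympl v))
    have h2 : ((Equiv.sumEmpty κ (Fin 0)).symm.prodCongr (Equiv.refl (Fin 2))).trans
        (sumPairs e (Equiv.refl (Fin 0 × Fin 2))) = e.trans (Equiv.sumEmpty ι (Fin 0 × Fin 2)).symm := by
      ext ⟨i, b⟩
      rfl
    rw [← h, h2, ← pf_submatrix_equiv]
    simp only [univ_eq_empty, prod_empty, one_mul]
    rfl
  | succ n ih =>
    have h := pf_congr_pairs (sumPairs e (Equiv.refl (Fin (n + 1) × Fin 2)))
      ((Equiv.sumAssoc κ (Fin n) (Fin 1)).trans ((Equiv.refl κ).sumCongr finSumFinEquiv))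
      (Matrix.fromBlocks A 0 0 (sympl v))
    -- The last pair is split off, so that `pf_fromBlocks_one` applies to it and the induction
    -- hypothesis to the rest.
    let f : (ι ⊕ Fin n × Fin 2) ⊕ Fin 1 × Fin 2 ≃ ι ⊕ Fin (n + 1) × Fin 2 :=
      (Equiv.sumAssoc _ _ _).trans ((Equiv.refl ι).sumCongr
        ((Equiv.sumProdDistrib _ _ _).symm.trans (finSumFinEquiv.prodCongr (Equiv.refl (Fin 2)))))
    have h2 : (((Equiv.sumAssoc κ (Fin n) (Fin 1)).trans
        ((Equiv.refl κ).sumCongr finSumFinEquiv)).prodCongr (Equiv.refl (Fin 2))).trans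
        (sumPairs e (Equiv.refl (Fin (n + 1) × Fin 2))) =
        (sumPairs (sumPairs e (Equiv.refl (Fin n × Fin 2))) (Equiv.refl (Fin 1 × Fin 2))).trans f := by
      apply Equiv.ext
      rintro ⟨(i | i) | i, b⟩ <;> rfl
    have h3 : (Matrix.fromBlocks A 0 0 (sympl v)).submatrix f f =
        Matrix.fromBlocks (Matrix.fromBlocks A 0 0 (sympl fun i : Fin n => v i.castSucc)) 0 0
          (sympl fun _ : Fin 1 => v (Fin.last n)) := by
      have hc : ∀ (i : Fin n) (j : Fin 1), Fin.castAdd 1 i ≠ Fin.natAdd n j := fun i j h => by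
        have := congrArg Fin.val h
        simp at this
        omega
      ext ((r | ⟨i, b⟩) | ⟨i, b⟩) ((r' | ⟨i', b'⟩) | ⟨i', b'⟩)
      · rfl
      · rfl
      · rfl
      · rfl
      · simp [f, sympl, Fin.castAdd, Fin.castSucc]
      · simp [f, sympl, hc]
      · rfl
      · simp [f, sympl, (hc _ _).symm]
      · fin_cases i
        fin_cases i'
        simp [f, sympl]
        exact Or.inl rfl
    rw [← h, h2, ← pf_submatrix_equiv, h3, pf_fromBlocks_one, ih, Fin.prod_univ_castSucc]
    · ring
    · rintro (r | r) (r' | r')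
      · exact hA r r'
      · simp
      · simp
      · exact sympl_skew (fun i : Fin n => v i.castSucc) r r'

end Blocks
-- Sums in which each of `k` labels occurs exactly once
/-- The labels `0, …, k - 1` followed by the points `w`. -/
def labelsAppend {X : Type*} {N k : ℕ} (hk : k ≤ N) (w : Fin (N - k) → X) : Fin N → X ⊕ Fin k :=
  Fin.append (fun i => Sum.inr i) (fun j => Sum.inl (w j)) ∘ Fin.cast (Nat.add_sub_of_le hk).symm

theorem append_cast_castLE {X : Type*} {N k : ℕ} (hk : k ≤ N) (a : Fin k → X) (b : Fin (N - k) → X)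
    (i : Fin k) :
    (Fin.append a b ∘ Fin.cast (Nat.add_sub_of_le hk).symm) (Fin.castLE hk i) = a i := by
  have : Fin.cast (Nat.add_sub_of_le hk).symm (Fin.castLE hk i) = Fin.castAdd (N - k) i := rfl
  rw [Function.comp_apply, this, Fin.append_left]

theorem append_cast_natAdd {X : Type*} {N k : ℕ} (hk : k ≤ N) (a : Fin k → X) (b : Fin (N - k) → X)
    (j : Fin (N - k)) :
    (Fin.append a b ∘ Fin.cast (Nat.add_sub_of_le hk).symm)
      (Fin.cast (Nat.add_sub_of_le hk) (Fin.natAdd k j)) = b j := by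
  rw [Function.comp_apply, Fin.cast_cast, Fin.cast_eq_self, Fin.append_right]

theorem forall_fin_split {N k : ℕ} (hk : k ≤ N) {p : Fin N → Prop}
    (h1 : ∀ i : Fin k, p (Fin.castLE hk i))
    (h2 : ∀ j : Fin (N - k), p (Fin.cast (Nat.add_sub_of_le hk) (Fin.natAdd k j))) (l : Fin N) :
    p l := by
  by_cases hl : l.1 < k
  · exact h1 ⟨l.1, hl⟩
  · have : Fin.cast (Nat.add_sub_of_le hk) (Fin.natAdd k ⟨l.1 - k, by omega⟩) = l := by
      ext
      simp
      omega
    rw [← this]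
    exact h2 _

/-- The positions of the labels form an injection `Fin k ↪ Fin N`, determined by any tuple with
nonzero term. Symmetry moves each injection to the standard one, and `N.descFactorial k` counts
them. -/
theorem tsum_eq_descFactorial_mul {X : Type*} {N k : ℕ} (hk : k ≤ N)
    (G : (Fin N → X ⊕ Fin k) → ℝ) (hsum : Summable G)
    (hsym : ∀ (τ : Equiv.Perm (Fin N)) g, G (g ∘ τ) = G g)
    (hsupp : ∀ g, G g ≠ 0 → ∀ i, ∃! j, g j = Sum.inr i) :
    ∑' g, G g = N.descFactorial k * ∑' w, G (labelsAppend hk w) := by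
  classical
  let F : (Fin k ↪ Fin N) → (Fin N → X ⊕ Fin k) → ℝ := fun p g =>
    if ∀ i, g (p i) = Sum.inr i then G g else 0
  have hF : ∀ g, G g = ∑ p, F p g := by
    intro g
    by_cases hg : G g = 0
    · simp [F, hg]
    have hu := hsupp g hg
    choose p hp hpu using hu
    let P : Fin k ↪ Fin N := ⟨p, fun i j hij => by
      have h1 := hp i
      rw [hij] at h1
      exact (Sum.inr_injective ((hp j).symm.trans h1)).symm⟩
    rw [sum_eq_single P]
    · simp only [F]
      rw [if_pos (show ∀ i, g (P i) = Sum.inr i from hp)]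
    · intro b _ hb
      simp only [F]
      rw [if_neg]
      intro h
      exact hb (DFunLike.ext _ _ fun i => hpu i _ (h i))
    · simp
  have hFs : ∀ p, Summable (F p) := fun p => by
    have : F p = Set.indicator {g | ∀ i, g (p i) = Sum.inr i} G := by
      funext g
      simp only [F, Set.indicator_apply, Set.mem_ofPred_eq]
    rw [this]
    exact hsum.indicator _
  have hFp : ∀ p, ∑' g, F p g = ∑' g, F (Fin.castLEEmb hk) g := by
    intro p
    -- Any two placements of the labels differ by a permutation of the positions.
    obtain ⟨τ, hτ⟩ := Equiv.Perm.exists_extending_pair (Fin.castLEEmb hk) p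
      (Fin.castLEEmb hk).injective p.injective
    rw [← Equiv.tsum_eq (τ.symm.arrowCongr (Equiv.refl (X ⊕ Fin k))) (F (Fin.castLEEmb hk))]
    refine tsum_congr fun g => ?_
    have h1 : τ.symm.arrowCongr (Equiv.refl (X ⊕ Fin k)) g = g ∘ τ := by
      funext x
      simp
    simp only [h1, F, hsym, Function.comp_apply, hτ]
  have hinj : Function.Injective (labelsAppend hk : (Fin (N - k) → X) → _) := by
    intro w w' h
    funext j
    have h1 := congrFun h (Fin.cast (Nat.add_sub_of_le hk) (Fin.natAdd k j))
    unfold labelsAppend at h1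
    rw [append_cast_natAdd hk, append_cast_natAdd hk] at h1
    exact Sum.inl_injective h1
  have hlast : ∑' g, F (Fin.castLEEmb hk) g = ∑' w, G (labelsAppend hk w) := by
    rw [← hinj.tsum_eq]
    · refine tsum_congr fun w => ?_
      simp only [F]
      rw [if_pos]
      intro i
      exact append_cast_castLE hk _ _ i
    · intro g hg
      simp only [F, Function.mem_support, ne_eq, ite_eq_right_iff, Classical.not_imp] at hg
      obtain ⟨h1, h2⟩ := hg
      have h3 : ∀ j : Fin (N - k), ∃ x, g (Fin.cast (Nat.add_sub_of_le hk) (Fin.natAdd k j)) =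
          Sum.inl x := by
        intro j
        rcases hx : g (Fin.cast (Nat.add_sub_of_le hk) (Fin.natAdd k j)) with x | i
        · exact ⟨x, rfl⟩
        · have h4 := (hsupp g h2 i).unique hx (h1 i)
          have h5 := congrArg Fin.val h4
          simp at h5
          omega
      choose w hw using h3
      refine ⟨w, funext fun l => ?_⟩
      revert l
      refine forall_fin_split hk (fun i => ?_) fun j => ?_
      · exact (append_cast_castLE hk _ _ i).trans (h1 i).symm
      · exact (append_cast_natAdd hk _ _ j).trans (hw j).symm
  rw [tsum_congr hF, Summable.tsum_finsetSum fun p _ => hFs p, sum_congr rfl fun p _ => hFp p,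
    sum_const, nsmul_eq_mul, hlast, card_univ, Fintype.card_embedding_eq, Fintype.card_fin,
    Fintype.card_fin]

/-- The indices `2 i` and `2 i + 1` form the `i`-th pair. -/
def finPairs (n : ℕ) : Fin n × Fin 2 ≃ Fin (2 * n) where
  toFun p := ⟨2 * p.1.1 + p.2.1, by omega⟩
  invFun a := (⟨a.1 / 2, by omega⟩, ⟨a.1 % 2, Nat.mod_lt _ two_pos⟩)
  left_inv p := by
    ext <;> simp <;> omega
  right_inv a := by
    ext
    simp
    omega

theorem pfaffian_eq_pf (n : ℕ) (A : Matrix (Fin (2 * n)) (Fin (2 * n)) ℝ) :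
    pfaffian n A = pf (finPairs n) A := by
  unfold pfaffian pf
  rw [Fintype.card_fin]
  rfl

/-! ### Schur complement of a symplectic block -/

section Schur

variable {κ ι : Type*} [Fintype κ] [Fintype ι] [DecidableEq ι] [DecidableEq κ]

theorem pf_fromBlocks_sympl_left (e : κ × Fin 2 ≃ ι) (A : Matrix ι ι ℝ)
    (hA : ∀ r r', A r r' = -A r' r) {n : ℕ} (v : Fin n → ℝ) :
    pf (sumPairs (Equiv.refl (Fin n × Fin 2)) e)
      (Matrix.fromBlocks (sympl v) 0 0 A) = (∏ i, v i) * pf e A := by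
  rw [← pf_fromBlocks_sympl e A hA v, ← pf_congr_pairs _ (Equiv.sumComm κ (Fin n))]
  have h2 : ((Equiv.sumComm κ (Fin n)).prodCongr (Equiv.refl (Fin 2))).trans
      (sumPairs (Equiv.refl (Fin n × Fin 2)) e) =
      (sumPairs e (Equiv.refl (Fin n × Fin 2))).trans (Equiv.sumComm _ _) := by
    apply Equiv.ext
    rintro ⟨i | i, b⟩ <;> rfl
  rw [h2, ← pf_submatrix_equiv]
  congr 1
  ext (r | r) (r' | r') <;> rfl

theorem mul_sympl_mul_transpose {m m' : Type*} (B : Matrix m (κ × Fin 2) ℝ)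
    (B' : Matrix m' (κ × Fin 2) ℝ) (v : κ → ℝ) (p : m) (q : m') :
    (B * sympl v * B'.transpose) p q =
      ∑ i, v i * (B p (i, 0) * B' q (i, 1) - B p (i, 1) * B' q (i, 0)) := by
  simp only [Matrix.mul_apply, Matrix.transpose_apply, sympl, Matrix.of_apply,
    Fintype.sum_prod_type, Fin.sum_univ_two, mul_ite, mul_zero]
  refine sum_congr rfl fun i _ => ?_
  simp
  ring

theorem sympl_mul_sympl (u : κ → ℝ) (hu : ∀ i, u i ≠ 0) :
    sympl u * sympl (fun i => -(u i)⁻¹) = 1 := by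
  ext ⟨i, b⟩ ⟨j, c⟩
  simp only [Matrix.mul_apply, sympl, Matrix.of_apply, Fintype.sum_prod_type, Fin.sum_univ_two]
  have := hu i
  by_cases h : i = j
  · subst h
    fin_cases b <;> fin_cases c <;> simp [this]
  · rw [Matrix.one_apply_ne (by simp [h])]
    refine sum_eq_zero fun x _ => ?_
    by_cases hx : i = x
    · subst hx
      simp [h]
    · simp [hx]

theorem sympl_transpose {κ : Type*} [DecidableEq κ] (u : κ → ℝ) : (sympl u).transpose = -sympl u := by
  ext p q
  rw [Matrix.transpose_apply, Matrix.neg_apply, sympl_skew]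

/-- Block elimination: with `N` the inverse of `sympl u`, the matrix is congruent to the direct sum
of the Schur complement and `sympl u` through the unipotent matrix `[1, B N; 0, 1]`, whose
determinant is `1`. -/
theorem pf_schur (e : κ × Fin 2 ≃ ι) {n : ℕ} (A : Matrix ι ι ℝ) (hA : ∀ r r', A r r' = -A r' r)
    (B : Matrix ι (Fin n × Fin 2) ℝ) (u : Fin n → ℝ) (hu : ∀ i, u i ≠ 0) :
    pf (sumPairs e (Equiv.refl (Fin n × Fin 2)))
      (Matrix.fromBlocks A B (-B.transpose) (sympl u)) =
      (∏ i, u i) * pf e (A + B * sympl (fun i => -(u i)⁻¹) * B.transpose) := by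
  set N := sympl (fun i => -(u i)⁻¹) with hN
  have h1 : sympl u * N = 1 := sympl_mul_sympl u hu
  have h2 : N * sympl u = 1 := mul_eq_one_comm.1 h1
  have hNt : N.transpose = -N := sympl_transpose _
  have hskew : ∀ r r', (A + B * N * B.transpose) r r' = -(A + B * N * B.transpose) r' r := by
    have h3 : (A + B * N * B.transpose).transpose = -(A + B * N * B.transpose) := by
      have hAt : A.transpose = -A := by
        ext r r'
        exact hA r' r
      rw [Matrix.transpose_add, Matrix.transpose_mul, Matrix.transpose_mul, hNt, hAt,
        Matrix.transpose_transpose]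
      simp only [Matrix.neg_mul, Matrix.mul_neg, Matrix.mul_assoc]
      abel
    intro r r'
    have := congrFun (congrFun h3 r') r
    simpa using this
  rw [← pf_fromBlocks_sympl e _ hskew u, ← one_mul (pf _ (Matrix.fromBlocks (A + _) _ _ _))]
  have hdet : (Matrix.fromBlocks 1 (B * N) 0 1 : Matrix (ι ⊕ Fin n × Fin 2) _ ℝ).det = 1 := by
    rw [Matrix.det_fromBlocks_zero₂₁]
    simp
  rw [← hdet, ← pf_mul_mul_transpose]
  congr 1
  rw [Matrix.fromBlocks_transpose, Matrix.fromBlocks_multiply, Matrix.fromBlocks_multiply]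
  simp only [Matrix.transpose_one, Matrix.transpose_zero, Matrix.transpose_mul, hNt, Matrix.one_mul,
    Matrix.mul_one, Matrix.mul_zero, Matrix.zero_mul, add_zero, zero_add, Matrix.neg_mul,
    Matrix.mul_neg]
  congr 1
  · rw [Matrix.mul_assoc (B * N) (sympl u), ← Matrix.mul_assoc (sympl u), h1, Matrix.one_mul]
    abel
  · rw [Matrix.mul_assoc, h2, Matrix.mul_one]
  · rw [← Matrix.mul_assoc, h1, Matrix.one_mul]

end Schur
-- De Bruijn's formula with fixed variables
section DeBruijn

variable {X : Type*} (s : X → X → ℝ) {n k : ℕ} (z : Fin k → X)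

/-- The extension of the skew form `s` by a hyperbolic form on two families of `k` labels. -/
def labelForm (k : ℕ) : (X ⊕ Fin k) ⊕ Fin k → (X ⊕ Fin k) ⊕ Fin k → ℝ
  | .inl (.inl x), .inl (.inl y) => s x y
  | .inr i, .inl (.inr j) => if i = j then 1 else 0
  | .inl (.inr i), .inr j => if i = j then -1 else 0
  | _, _ => 0

theorem labelForm_skew (hs : ∀ x y, s x y = -s y x) (k : ℕ) :
    ∀ a b, labelForm s k a b = -labelForm s k b a := by
  rintro ((x | i) | i) ((y | j) | j)
  · exact hs x y
  all_goals simp only [labelForm, neg_zero]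
  all_goals split_ifs <;> simp_all

/-- The labels of the first `2 k` rows: the second family of labels and the fixed points. -/
def fixedLabels (p : Fin k × Fin 2) : (X ⊕ Fin k) ⊕ Fin k :=
  if p.2 = 0 then Sum.inr p.1 else Sum.inl (Sum.inl (z p.1))

/-- The Pfaffian of the form on the fixed labels and the labels `h`. -/
noncomputable def labelPf (h : Fin (2 * n) → X ⊕ Fin k) : ℝ :=
  pf (sumPairs (Equiv.refl (Fin k × Fin 2)) (finPairs n))
    (Matrix.of fun r r' => labelForm s k
      (Sum.elim (fixedLabels z) (fun l => Sum.inl (h l)) r)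
      (Sum.elim (fixedLabels z) (fun l => Sum.inl (h l)) r'))

theorem labelPf_perm (τ : Equiv.Perm (Fin (2 * n))) (h : Fin (2 * n) → X ⊕ Fin k) :
    labelPf s z (h ∘ τ) = ((Equiv.Perm.sign τ : ℤ) : ℝ) * labelPf s z h := by
  have h1 := pf_submatrix_perm (sumPairs (Equiv.refl (Fin k × Fin 2)) (finPairs n))
    ((1 : Equiv.Perm (Fin k × Fin 2)).sumCongr τ)
    (Matrix.of fun r r' => labelForm s k
      (Sum.elim (fixedLabels z) (fun l => Sum.inl (h l)) r)
      (Sum.elim (fixedLabels z) (fun l => Sum.inl (h l)) r'))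
  rw [Equiv.Perm.sign_sumCongr, Equiv.Perm.sign_one, one_mul] at h1
  unfold labelPf
  rw [← h1]
  congr 1
  ext (r | r) (r' | r') <;> rfl

/-- The partner of label `i` pairs only with that label, so its row vanishes if `h` omits the label;
a label occurring twice gives two equal rows. -/
theorem labelPf_existsUnique (hs : ∀ x y, s x y = -s y x) (h : Fin (2 * n) → X ⊕ Fin k)
    (hne : labelPf s z h ≠ 0) (i : Fin k) : ∃! j, h j = Sum.inr i := by
  have hex : ∃ j, h j = Sum.inr i := by
    by_contra! hno
    refine hne (pf_eq_zero_of_row _ _ (fun r r' => labelForm_skew s hs k _ _)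
      (Sum.inl (i, 0)) ?_)
    rintro (⟨j, b⟩ | l)
    · fin_cases b <;> simp [fixedLabels, labelForm]
    · rcases hl : h l with x | j
      · simp [fixedLabels, labelForm, hl]
      · have : i ≠ j := by
          rintro rfl
          exact hno l hl
        simp [fixedLabels, labelForm, hl, this]
  obtain ⟨j, hj⟩ := hex
  refine ⟨j, hj, fun l hl => ?_⟩
  by_contra hlj
  refine hne (pf_submatrix_eq_zero _ (Matrix.of (labelForm s k))
    (Sum.elim (fixedLabels z) (fun l => Sum.inl (h l))) fun hinj => hlj ?_)
  have : (Sum.inr l : (Fin k × Fin 2) ⊕ Fin (2 * n)) = Sum.inr j := hinj (by simp [hl, hj])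
  exact Sum.inr_injective this

/-- For each `i` the row of the point `z i` is interchanged with the row carrying label `i`. These
`k` transpositions give `(-1) ^ k`. Afterwards each partner stands next to its label, forming `k`
hyperbolic blocks, and the last `2 n` rows carry the fixed and free points in order. -/
theorem labelPf_labelsAppend (hs : ∀ x y, s x y = -s y x) (hk : k ≤ 2 * n)
    (w : Fin (2 * n - k) → X) :
    labelPf s z (labelsAppend hk w) = (-1) ^ k * pfaffian n (Matrix.of fun i j =>
      s ((Fin.append z w ∘ Fin.cast (Nat.add_sub_of_le hk).symm) i)
        ((Fin.append z w ∘ Fin.cast (Nat.add_sub_of_le hk).symm) j)) := by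
  set v := Fin.append z w ∘ Fin.cast (Nat.add_sub_of_le hk).symm with hv
  -- The image of `φ` lists the rows to be interchanged, two for each `i`; `τ` swaps them and fixes
  -- all other rows.
  let φ : Fin k × Fin 2 ↪ (Fin k × Fin 2) ⊕ Fin (2 * n) :=
    ⟨fun p => if p.2 = 0 then Sum.inl (p.1, 1) else Sum.inr (Fin.castLE hk p.1), by
      rintro ⟨i, b⟩ ⟨j, c⟩ h
      fin_cases b <;> fin_cases c <;> simp at h ⊢ <;> exact h⟩
  have hφ0 : ∀ i, φ (i, 0) = Sum.inl (i, 1) := fun _ => rfl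
  have hφ1 : ∀ i, φ (i, 1) = Sum.inr (Fin.castLE hk i) := fun _ => rfl
  let ρ : Equiv.Perm (Fin k × Fin 2) := Equiv.prodCongrRight fun _ => Equiv.swap 0 1
  let τ := ρ.viaFintypeEmbedding φ
  have hsign : ((Equiv.Perm.sign τ : ℤ) : ℝ) = (-1) ^ k := by
    simp [τ, ρ, Equiv.Perm.viaFintypeEmbedding_sign, Equiv.Perm.sign_prodCongrRight]
  have ha : ∀ i, τ (Sum.inl (i, 1)) = Sum.inr (Fin.castLE hk i) := fun i =>
    (ρ.viaFintypeEmbedding_apply_image φ (i, 0)).trans (by simp [hφ1, ρ])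
  have hb : ∀ i, τ (Sum.inr (Fin.castLE hk i)) = Sum.inl (i, 1) := fun i =>
    (ρ.viaFintypeEmbedding_apply_image φ (i, 1)).trans (by simp [hφ0, ρ])
  have hc : ∀ i, τ (Sum.inl (i, 0)) = Sum.inl (i, 0) := fun i =>
    ρ.viaFintypeEmbedding_apply_notMem_range φ (by
      rintro ⟨⟨j, b⟩, h⟩
      fin_cases b <;> simp [hφ0, hφ1] at h)
  have hd : ∀ j : Fin (2 * n - k), τ (Sum.inr (Fin.cast (Nat.add_sub_of_le hk) (Fin.natAdd k j))) =
      Sum.inr (Fin.cast (Nat.add_sub_of_le hk) (Fin.natAdd k j)) := fun j =>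
    ρ.viaFintypeEmbedding_apply_notMem_range φ (by
      rintro ⟨⟨i, b⟩, h⟩
      fin_cases b
      · simp [hφ0] at h
      · have := congrArg Fin.val (Sum.inr_injective h)
        simp at this
        omega)
  let L : (Fin k × Fin 2) ⊕ Fin (2 * n) → (X ⊕ Fin k) ⊕ Fin k :=
    Sum.elim (fixedLabels z) (fun l => Sum.inl (labelsAppend hk w l))
  have hL : ∀ r, L (τ r) = Sum.elim
      (fun p : Fin k × Fin 2 => if p.2 = 0 then Sum.inr p.1 else Sum.inl (Sum.inr p.1))
      (fun l => Sum.inl (Sum.inl (v l))) r := by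
    rintro (⟨i, b⟩ | l)
    · fin_cases b
      · simp only [Fin.zero_eta, hc]
        simp [L, fixedLabels]
      · simp only [Fin.mk_one, ha, L, Sum.elim_inr, Sum.elim_inl, labelsAppend,
          append_cast_castLE hk]
        simp
    · revert l
      refine forall_fin_split hk (fun i => ?_) fun j => ?_
      · simp only [hb, L, Sum.elim_inr, Sum.elim_inl, hv, append_cast_castLE hk]
        simp [fixedLabels]
      · simp only [hd, L, Sum.elim_inr, hv, labelsAppend, append_cast_natAdd hk]
  have h1 := pf_submatrix_perm (sumPairs (Equiv.refl (Fin k × Fin 2)) (finPairs n)) τ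
    (Matrix.of fun r r' => labelForm s k (L r) (L r'))
  have h2 : (Matrix.of fun r r' => labelForm s k (L r) (L r')).submatrix τ τ =
      Matrix.fromBlocks (sympl fun _ : Fin k => 1) 0 0 (Matrix.of fun i j => s (v i) (v j)) := by
    ext r r'
    rw [Matrix.submatrix_apply, Matrix.of_apply, hL, hL]
    rcases r with ⟨i, b⟩ | l <;> rcases r' with ⟨j, c⟩ | l'
    · fin_cases b <;> fin_cases c <;> simp [labelForm, sympl]
    · fin_cases b <;> simp [labelForm]
    · fin_cases c <;> simp [labelForm]
    · simp [labelForm]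
  rw [h2, pf_fromBlocks_sympl_left _ (Matrix.of fun i j => s (v i) (v j)) (fun i j => hs (v i) (v j)), prod_const_one, one_mul, hsign,
    ← pfaffian_eq_pf] at h1
  rw [h1, ← mul_assoc, ← mul_pow]
  simp
  rfl

/-- The weights of the last `2 n` rows. -/
def rowWeight (φ ψ : Fin (2 * n) → X → ℝ) (r : Fin (2 * n)) : X ⊕ Fin k → ℝ :=
  Sum.elim (φ r) fun i => ψ r (z i)

/-- This is `pf_hasSum` on the enlarged label set. A fixed row is a point mass at its label, so
pairing with it evaluates the form there: the partner of `i` extracts `ψ r (z i)`, and the point `z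
i` the sum `b i r`. -/
theorem hasSum_labelPf (φ ψ : Fin (2 * n) → X → ℝ) (b : Fin k → Fin (2 * n) → ℝ)
    (hb : ∀ i r, HasSum (fun x => s (z i) x * φ r x) (b i r))
    (hs : ∀ x y, s x y = -s y x)
    (D : Matrix (Fin (2 * n)) (Fin (2 * n)) ℝ)
    (hD : ∀ r r', HasSum (fun p : X × X => φ r p.1 * φ r' p.2 * s p.1 p.2) (D r r')) :
    HasSum (fun h : Fin (2 * n) → X ⊕ Fin k => (∏ r, rowWeight z φ ψ r (h r)) * labelPf s z h)
      (pf (sumPairs (Equiv.refl (Fin k × Fin 2)) (finPairs n))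
        (Matrix.fromBlocks
          (Matrix.of fun p q => if p.2 = 0 then 0 else if q.2 = 0 then 0 else s (z p.1) (z q.1))
          (Matrix.of fun p r => if p.2 = 0 then ψ r (z p.1) else b p.1 r)
          (-(Matrix.of fun p r => if p.2 = 0 then ψ r (z p.1) else b p.1 r).transpose) D)) := by
  classical
  let Y := (X ⊕ Fin k) ⊕ Fin k
  let Φ : (Fin k × Fin 2) ⊕ Fin (2 * n) → Y → ℝ :=
    Sum.elim (fun p => Pi.single (fixedLabels z p) 1)
      fun r => Sum.elim (rowWeight z φ ψ r) 0
  have hrow : ∀ (p : Fin k × Fin 2) (r : Fin (2 * n)),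
      HasSum (fun y : Y => Φ (Sum.inr r) y * labelForm s k (fixedLabels z p) y)
        (if p.2 = 0 then ψ r (z p.1) else b p.1 r) := by
    rintro ⟨i, c⟩ r
    fin_cases c
    · convert hasSum_single (Sum.inl (Sum.inr i) : Y) _ using 1
      · simp [Φ, rowWeight, fixedLabels, labelForm]
      · rintro ((x | j) | j) hne
        · simp [labelForm, fixedLabels]
        · have : i ≠ j := by
            rintro rfl
            exact hne rfl
          simp [labelForm, fixedLabels, this]
        · simp [labelForm, fixedLabels]
    · have hinj : Function.Injective (fun x : X => (Sum.inl (Sum.inl x) : Y)) :=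
        Sum.inl_injective.comp Sum.inl_injective
      rw [← hinj.hasSum_iff]
      · refine (congrArg (fun F => HasSum F (b i r)) (funext fun x => ?_)).mp (hb i r)
        simp [Φ, rowWeight, fixedLabels, labelForm, mul_comm]
      · rintro ((x | j) | j) hne
        · exact absurd ⟨x, rfl⟩ hne
        · simp [labelForm, fixedLabels]
        · simp [labelForm, fixedLabels]
  have hsing : ∀ (p : Fin k × Fin 2) (f : Y → ℝ) (a : ℝ),
      HasSum (fun y : Y => f y * labelForm s k (fixedLabels z p) y) a →
      HasSum (fun q : Y × Y => Φ (Sum.inl p) q.1 * f q.2 * labelForm s k q.1 q.2) a := by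
    intro p f a hf
    have hinj : Function.Injective (fun y : Y => (fixedLabels z p, y)) := fun y y' h => by
      simpa using h
    rw [← hinj.hasSum_iff]
    · convert hf using 1
      funext y
      simp [Φ]
    · rintro ⟨y, y'⟩ hne
      have : y ≠ fixedLabels z p := by
        rintro rfl
        exact hne ⟨y', rfl⟩
      simp [Φ, Pi.single_eq_of_ne this]
  have key := pf_hasSum (sumPairs (Equiv.refl (Fin k × Fin 2)) (finPairs n)) Φ (labelForm s k)
    (Matrix.fromBlocks
          (Matrix.of fun p q => if p.2 = 0 then 0 else if q.2 = 0 then 0 else s (z p.1) (z q.1))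
          (Matrix.of fun p r => if p.2 = 0 then ψ r (z p.1) else b p.1 r)
          (-(Matrix.of fun p r => if p.2 = 0 then ψ r (z p.1) else b p.1 r).transpose) D) (by
    rintro (p | r) (q | r')
    · refine hsing p _ _ ?_
      convert hasSum_single (fixedLabels z q) _ using 1
      · simp only [Φ, Sum.elim_inl, Pi.single_eq_same, one_mul, Matrix.fromBlocks_apply₁₁,
          Matrix.of_apply]
        obtain ⟨i, c⟩ := p
        obtain ⟨j, d⟩ := q
        fin_cases c <;> fin_cases d <;> simp [fixedLabels, labelForm]
      · intro y hy
        simp [Φ, Pi.single_eq_of_ne hy]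
    · exact hsing p _ _ (hrow p r')
    · have h1 := (hsing q _ _ (hrow q r)).neg
      rw [← (Equiv.prodComm Y Y).hasSum_iff] at h1
      refine (congrArg (fun F => HasSum F _) (funext fun y => ?_)).mp h1
      simp only [Function.comp_apply, Equiv.prodComm_apply, Prod.fst_swap, Prod.snd_swap]
      rw [labelForm_skew s hs]
      ring
    · have hinj : Function.Injective
          (fun p : X × X => ((Sum.inl (Sum.inl p.1), Sum.inl (Sum.inl p.2)) : Y × Y)) := by
        rintro ⟨x, y⟩ ⟨x', y'⟩ h
        simp only [Prod.mk.injEq] at h ⊢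
        exact ⟨Sum.inl_injective (Sum.inl_injective h.1), Sum.inl_injective (Sum.inl_injective h.2)⟩
      rw [← hinj.hasSum_iff]
      · exact hD r r'
      · rintro ⟨(x | i) | i, (y | j) | j⟩ hne
        · exact absurd ⟨(x, y), rfl⟩ hne
        all_goals simp [labelForm, Φ])
  have hinj : Function.Injective (fun (h : Fin (2 * n) → X ⊕ Fin k) =>
      (Sum.elim (fixedLabels z) (fun l => Sum.inl (h l)) :
        (Fin k × Fin 2) ⊕ Fin (2 * n) → Y)) := by
    intro h h' he
    funext l
    exact Sum.inl_injective (congrFun he (Sum.inr l))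
  rw [← hinj.hasSum_iff] at key
  · convert key using 1
    funext h
    simp [Fintype.prod_sum_type, Φ, labelPf]
  -- A labelling of all rows has weight zero unless the first `2 k` rows carry their prescribed
  -- labels and the others avoid the partners, that is, unless it comes from some `h`.
  · intro f hf
    have hz : ∏ r, Φ r (f r) = 0 := by
      by_contra hne
      rw [prod_eq_zero_iff] at hne
      push Not at hne
      apply hf
      have h1 : ∀ l, ∃ x, f (Sum.inr l) = Sum.inl x := by
        intro l
        rcases hx : f (Sum.inr l) with x | x
        · exact ⟨x, rfl⟩
        · have := hne (Sum.inr l) (mem_univ _)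
          simp [Φ, hx] at this
      choose h hh using h1
      refine ⟨h, funext ?_⟩
      rintro (p | l)
      · by_contra hp
        exact hne (Sum.inl p) (mem_univ _) (by
          simp only [Φ, Sum.elim_inl]
          exact Pi.single_eq_of_ne (Ne.symm hp) _)
      · exact (hh l).symm
    rw [hz, zero_mul]

/-- `labelPf` is alternating, so averaging the product of row weights over the permutations of the
arguments turns it into a determinant. -/
theorem hasSum_det_mul_labelPf (φ ψ : Fin (2 * n) → X → ℝ) (a : ℝ)
    (h : HasSum (fun h : Fin (2 * n) → X ⊕ Fin k =>
      (∏ r, rowWeight z φ ψ r (h r)) * labelPf s z h) a) :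
    HasSum (fun h : Fin (2 * n) → X ⊕ Fin k =>
      (Matrix.of fun r l => rowWeight z φ ψ r (h l)).det * labelPf s z h)
      ((2 * n).factorial * a) := by
  have h1 : HasSum (fun h : Fin (2 * n) → X ⊕ Fin k => ∑ τ : Equiv.Perm (Fin (2 * n)),
      (∏ r, rowWeight z φ ψ r (h (τ r))) * labelPf s z (h ∘ τ))
      (∑ _τ : Equiv.Perm (Fin (2 * n)), a) := by
    refine hasSum_sum fun τ _ => ?_
    have := (Equiv.hasSum_iff (τ.symm.arrowCongr (Equiv.refl (X ⊕ Fin k)))).2 h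
    convert this using 1
    funext g
    have hg : τ.symm.arrowCongr (Equiv.refl (X ⊕ Fin k)) g = g ∘ τ := by
      funext x
      simp
    rw [Function.comp_apply, hg]
    rfl
  rw [sum_const, card_univ, Fintype.card_perm, Fintype.card_fin, nsmul_eq_mul] at h1
  convert h1 using 1
  funext g
  rw [← Matrix.det_transpose, Matrix.det_apply', sum_mul]
  refine sum_congr rfl fun τ _ => ?_
  rw [labelPf_perm]
  simp
  ring

/-- De Bruijn's formula with `k` variables that are not summed over. -/
theorem tsum_pfaffian_mul_det (φ ψ : Fin (2 * n) → X → ℝ) (W : X → ℝ)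
    (hφ : ∀ r x, φ r x = ψ r x * W x) (b : Fin k → Fin (2 * n) → ℝ)
    (hb : ∀ i r, HasSum (fun x => s (z i) x * φ r x) (b i r))
    (hs : ∀ x y, s x y = -s y x) (hk : k ≤ 2 * n)
    (D : Matrix (Fin (2 * n)) (Fin (2 * n)) ℝ)
    (hD : ∀ r r', HasSum (fun p : X × X => φ r p.1 * φ r' p.2 * s p.1 p.2) (D r r')) :
    ∑' w : Fin (2 * n - k) → X,
      pfaffian n (Matrix.of fun i j =>
        s ((Fin.append z w ∘ Fin.cast (Nat.add_sub_of_le hk).symm) i)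
          ((Fin.append z w ∘ Fin.cast (Nat.add_sub_of_le hk).symm) j)) *
      (Matrix.of fun r l =>
        ψ r ((Fin.append z w ∘ Fin.cast (Nat.add_sub_of_le hk).symm) l)).det * ∏ j, W (w j) =
      (2 * n - k).factorial * ((-1) ^ k *
        pf (sumPairs (Equiv.refl (Fin k × Fin 2)) (finPairs n))
        (Matrix.fromBlocks
          (Matrix.of fun p q => if p.2 = 0 then 0 else if q.2 = 0 then 0 else s (z p.1) (z q.1))
          (Matrix.of fun p r => if p.2 = 0 then ψ r (z p.1) else b p.1 r)
          (-(Matrix.of fun p r => if p.2 = 0 then ψ r (z p.1) else b p.1 r).transpose) D)) := by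
  have h1 := hasSum_det_mul_labelPf s z φ ψ _ (hasSum_labelPf s z φ ψ b hb hs D hD)
  -- Determinant and Pfaffian are both alternating, so their product is symmetric.
  have h2 := tsum_eq_descFactorial_mul hk _ h1.summable (by
      intro τ g
      have := Matrix.det_permute' τ (Matrix.of fun r l => rowWeight z φ ψ r (g l))
      change ((Matrix.of fun r l => rowWeight z φ ψ r (g l)).submatrix id τ).det * _ = _
      rw [this, labelPf_perm]
      have hu : ((Equiv.Perm.sign τ : ℤ) : ℝ) * ((Equiv.Perm.sign τ : ℤ) : ℝ) = 1 := by
        exact_mod_cast Int.units_coe_mul_self _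
      linear_combination ((Matrix.of fun r l => rowWeight z φ ψ r (g l)).det * labelPf s z g) * hu)
    (fun g hg => labelPf_existsUnique s z hs g (right_ne_zero_of_mul hg))
  rw [h1.tsum_eq] at h2
  have h3 : ∀ w : Fin (2 * n - k) → X,
      (Matrix.of fun r l => rowWeight z φ ψ r (labelsAppend hk w l)).det *
        labelPf s z (labelsAppend hk w) =
      (-1) ^ k * (pfaffian n (Matrix.of fun i j =>
        s ((Fin.append z w ∘ Fin.cast (Nat.add_sub_of_le hk).symm) i)
          ((Fin.append z w ∘ Fin.cast (Nat.add_sub_of_le hk).symm) j)) *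
      (Matrix.of fun r l =>
        ψ r ((Fin.append z w ∘ Fin.cast (Nat.add_sub_of_le hk).symm) l)).det *
          ∏ j, W (w j)) := by
    intro w
    -- Only summed points carry the weight `W`; the columns of fixed points get the factor `1`.
    set c : Fin (2 * n) → ℝ := Fin.append (fun _ : Fin k => (1 : ℝ)) (fun j => W (w j)) ∘
      Fin.cast (Nat.add_sub_of_le hk).symm with hc
    have hdet : (Matrix.of fun r l => rowWeight z φ ψ r (labelsAppend hk w l)) =
        Matrix.of fun r l => c l *
          (Matrix.of fun r l =>
            ψ r ((Fin.append z w ∘ Fin.cast (Nat.add_sub_of_le hk).symm) l)) r l := by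
      ext r l
      simp only [Matrix.of_apply]
      revert l
      refine forall_fin_split hk (fun i => ?_) fun j => ?_
      · rw [labelsAppend, append_cast_castLE hk, hc, append_cast_castLE hk, append_cast_castLE hk]
        simp [rowWeight]
      · rw [labelsAppend, append_cast_natAdd hk, hc, append_cast_natAdd hk, append_cast_natAdd hk]
        simp [rowWeight, hφ, mul_comm]
    have hprod : ∏ l, c l = ∏ j, W (w j) := by
      rw [hc]
      simp only [Function.comp_apply]
      refine (Equiv.prod_comp (finCongr (Nat.add_sub_of_le hk).symm)
        (Fin.append (fun _ : Fin k => (1 : ℝ)) (fun j => W (w j)))).trans ?_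
      rw [Fin.prod_univ_add]
      simp
    rw [hdet, Matrix.det_mul_row, hprod, labelPf_labelsAppend s z hs hk]
    ring
  rw [tsum_congr h3, tsum_mul_left] at h2
  have hfac := Nat.factorial_mul_descFactorial hk
  have hd : ((2 * n).descFactorial k : ℝ) ≠ 0 := by
    exact_mod_cast (Nat.descFactorial_pos.2 hk).ne'
  rw [← hfac] at h2
  push_cast at h2
  have hsq : ((-1 : ℝ) ^ k) * (-1) ^ k = 1 := by rw [← mul_pow]; simp
  have aux : ∀ d f e P S : ℝ, e * e = 1 → f * d * P = d * (e * S) → d * S = d * (f * (e * P)) :=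
    fun d f e P S he h => by linear_combination (-(d * S)) * he - e * h
  exact mul_left_cancel₀ hd (aux _ _ _ _ _ hsq h2)

end DeBruijn
-- The skew inner product as a double lattice sum
theorem hasSum_sum_type {α β : Type*} {f : α ⊕ β → ℝ} {a b : ℝ}
    (ha : HasSum (fun x => f (Sum.inl x)) a) (hb : HasSum (fun x => f (Sum.inr x)) b) :
    HasSum f (a + b) := by
  have h1 : HasSum (Sum.elim (fun x => f (Sum.inl x)) 0 : α ⊕ β → ℝ) a := by
    rw [← Sum.inl_injective.hasSum_iff]
    · exact ha
    · rintro (x | x) hx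
      · exact absurd ⟨x, rfl⟩ hx
      · rfl
  have h2 : HasSum (Sum.elim 0 (fun x => f (Sum.inr x)) : α ⊕ β → ℝ) b := by
    rw [← Sum.inr_injective.hasSum_iff]
    · exact hb
    · rintro (x | x) hx
      · rfl
      · exact absurd ⟨x, rfl⟩ hx
  refine (congrArg (fun F => HasSum F (a + b)) (funext fun x => ?_)).mp (h1.add h2)
  rcases x with x | x <;> simp

theorem hasSum_prod_sum_type {α β : Type*} {f : (α ⊕ β) × (α ⊕ β) → ℝ} {a b c d : ℝ}
    (ha : HasSum (fun p : α × α => f (Sum.inl p.1, Sum.inl p.2)) a)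
    (hb : HasSum (fun p : α × β => f (Sum.inl p.1, Sum.inr p.2)) b)
    (hc : HasSum (fun p : β × α => f (Sum.inr p.1, Sum.inl p.2)) c)
    (hd : HasSum (fun p : β × β => f (Sum.inr p.1, Sum.inr p.2)) d) :
    HasSum f (a + b + (c + d)) := by
  rw [← (Equiv.sumProdDistrib α β (α ⊕ β)).symm.hasSum_iff]
  refine hasSum_sum_type ?_ ?_
  · rw [← (Equiv.prodSumDistrib α α β).symm.hasSum_iff]
    exact hasSum_sum_type ha hb
  · rw [← (Equiv.prodSumDistrib β α β).symm.hasSum_iff]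
    exact hasSum_sum_type hc hd

theorem hasSum_indicator_range {α β : Type*} {g : α → β} (hg : Function.Injective g) (F : β → ℝ)
    {a : ℝ} (h : HasSum (F ∘ g) a) : HasSum (Set.indicator (Set.range g) F) a := by
  rw [← hg.hasSum_iff fun x hx => Set.indicator_of_notMem hx _]
  have : Set.indicator (Set.range g) F ∘ g = F ∘ g := by
    funext x
    exact Set.indicator_of_mem (Set.mem_range_self x) F
  rw [this]
  exact h

/-- The kernel is the indicator of the pairs `(od p, ev p.1)` minus that of the swapped pairs. In
the applications `ev l` is a point `y` of the outer integral and `od (l, m)` the `m`-th point below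
`q ^ (1/2) y`. -/
theorem hasSum_half_kernel {Z Λ : Type*} (h : Z → Z → ℝ) (ev : Λ → Z) (od : Λ × ℕ → Z)
    (hinj : Function.Injective fun p : Λ × ℕ => (od p, ev p.1))
    (h1 : ∀ p, h (od p) (ev p.1) = 1) (h2 : ∀ p, h (ev p.1) (od p) = -1)
    (h0 : ∀ x y, (∀ p, ¬(x = od p ∧ y = ev p.1)) → (∀ p, ¬(y = od p ∧ x = ev p.1)) → h x y = 0)
    (Φ Ψ : Z → ℝ) (hΦ : Summable Φ) (hΨ : Summable Ψ) :
    ∃ S, HasSum (fun p : Z × Z => Φ p.1 * Ψ p.2 * h p.1 p.2) S ∧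
      HasSum (fun l => ∑' m, (Φ (od (l, m)) * Ψ (ev l) - Ψ (od (l, m)) * Φ (ev l))) S := by
  classical
  let g : Λ × ℕ → Z × Z := fun p => (od p, ev p.1)
  have hg : Function.Injective g := hinj
  have hg' : Function.Injective (Prod.swap ∘ g) := Prod.swap_injective.comp hinj
  have hs := summable_mul_prod hΦ hΨ
  have hA := (hs.comp_injective hg).hasSum
  have hB := (hs.comp_injective hg').hasSum
  have hd := hA.sub hB
  have hd' := hd.prod_fiberwise fun l => (hd.summable.prod_factor l).hasSum
  refine ⟨_, ?_, (congrArg (fun F => HasSum F _) (funext fun l => tsum_congr fun m => ?_)).mp hd'⟩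
  · have hAB := (hasSum_indicator_range hg _ hA).sub (hasSum_indicator_range hg' _ hB)
    refine (congrArg (fun F => HasSum F _) (funext fun p => ?_)).mp hAB
    obtain ⟨x, y⟩ := p
    by_cases hx : (x, y) ∈ Set.range g
    · obtain ⟨p, hp⟩ := hx
      obtain ⟨rfl, rfl⟩ : od p = x ∧ ev p.1 = y := by simpa [g] using hp
      have hn : (od p, ev p.1) ∉ Set.range (Prod.swap ∘ g) := by
        rintro ⟨p', hp'⟩
        have h3 : ev p'.1 = od p ∧ od p' = ev p.1 := by simpa [g] using hp'
        have h4 := h1 p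
        rw [← h3.1, ← h3.2, h2] at h4
        norm_num at h4
      rw [Set.indicator_of_mem (show (od p, ev p.1) ∈ Set.range g from ⟨p, rfl⟩),
          Set.indicator_of_notMem hn, h1]
      ring
    · rw [Set.indicator_of_notMem hx]
      by_cases hy : (x, y) ∈ Set.range (Prod.swap ∘ g)
      · obtain ⟨p, hp⟩ := hy
        obtain ⟨rfl, rfl⟩ : ev p.1 = x ∧ od p = y := by simpa [g] using hp
        rw [Set.indicator_of_mem
            (show (ev p.1, od p) ∈ Set.range (Prod.swap ∘ g) from ⟨p, rfl⟩), h2]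
        ring
      · rw [Set.indicator_of_notMem hy, h0]
        · ring
        · rintro p ⟨rfl, rfl⟩
          exact hx ⟨p, rfl⟩
        · rintro p ⟨rfl, rfl⟩
          exact hy ⟨p, rfl⟩
  · simp only [Function.comp_apply, g, Prod.fst_swap, Prod.snd_swap]
    ring

theorem halfSign_odd_even {l m : ℤ} (h : l ≤ m) : halfSign (2 * m + 1) (2 * l) = 1 :=
  if_pos ⟨m, l, rfl, rfl, h⟩

theorem halfSign_even_odd {l m : ℤ} (h : l ≤ m) : halfSign (2 * l) (2 * m + 1) = -1 := by
  unfold halfSign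
  rw [if_neg, if_pos ⟨m, l, rfl, rfl, h⟩]
  rintro ⟨m', l', h1, h2, -⟩
  omega

theorem halfSign_skew (i j : ℤ) : halfSign i j = -halfSign j i := by
  by_cases h1 : ∃ m n : ℤ, i = 2 * m + 1 ∧ j = 2 * n ∧ n ≤ m
  · obtain ⟨m, n, rfl, rfl, h⟩ := h1
    rw [halfSign_odd_even h, halfSign_even_odd h, neg_neg]
  · by_cases h2 : ∃ m n : ℤ, i = 2 * n ∧ j = 2 * m + 1 ∧ n ≤ m
    · obtain ⟨m, n, rfl, rfl, h⟩ := h2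
      rw [halfSign_odd_even h, halfSign_even_odd h]
    · have h3 : ¬∃ m n : ℤ, j = 2 * m + 1 ∧ i = 2 * n ∧ n ≤ m :=
        fun ⟨m, n, a, b, c⟩ => h2 ⟨m, n, b, a, c⟩
      have h4 : ¬∃ m n : ℤ, j = 2 * n ∧ i = 2 * m + 1 ∧ n ≤ m :=
        fun ⟨m, n, a, b, c⟩ => h1 ⟨m, n, b, a, c⟩
      unfold halfSign
      rw [if_neg h1, if_neg h2, if_neg h3, if_neg h4, neg_zero]

theorem abs_halfSign_le (i j : ℤ) : |halfSign i j| ≤ 1 := by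
  unfold halfSign
  split_ifs <;> simp

theorem skewKer_skew (q : ℝ) : ∀ (C : Contour) (x y : C.Site), skewKer q C x y = -skewKer q C y x
  | .ray, i, j => by
      change (1 + √q) ^ 2 * halfSign i j = -((1 + √q) ^ 2 * halfSign j i)
      rw [halfSign_skew]
      ring
  | .interval a b, .inl i, .inl j => by
      change (1 + √q) ^ 2 * halfSign i j = -((1 + √q) ^ 2 * halfSign j i)
      rw [halfSign_skew]
      ring
  | .interval a b, .inr i, .inr j => by
      change -((1 + √q) ^ 2 * halfSign i j) = - -((1 + √q) ^ 2 * halfSign j i)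
      rw [halfSign_skew]
      ring
  | .interval a b, .inr i, .inl j => by
      simp only [skewKer, and_comm, neg_neg]
  | .interval a b, .inl i, .inr j => by
      simp only [skewKer, and_comm]

theorem abs_skewKer_le (q : ℝ) :
    ∀ (C : Contour) (x y : C.Site), |skewKer q C x y| ≤ (1 + √q) ^ 2 := by
  have h : ∀ t : ℝ, |t| ≤ 1 → |(1 + √q) ^ 2 * t| ≤ (1 + √q) ^ 2 := fun t ht => by
    rw [abs_mul, abs_of_nonneg (sq_nonneg _)]
    exact mul_le_of_le_one_right (sq_nonneg _) ht
  have h' : ∀ p : Prop, ∀ _ : Decidable p, |if p then (1 : ℝ) else 0| ≤ 1 := fun p _ => by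
    split_ifs <;> simp
  rintro (_ | ⟨a, b⟩) x y
  · exact h _ (abs_halfSign_le _ _)
  · rcases x with i | i <;> rcases y with j | j <;> simp only [skewKer, abs_neg]
    · exact h _ (abs_halfSign_le _ _)
    · exact h _ (h' _ _)
    · exact h _ (h' _ _)
    · exact h _ (abs_halfSign_le _ _)

/-- Here `r = √q`. The lattice of the outer integral is the even powers of `r`, that of the inner
one the odd powers `r ^ (2 (l + m) + 1)`. The factor `(1 + r) ^ 2` arises from `1 - q = (1 - r) (1 +
r)` in each of the two integrals. -/
theorem hasSum_skewInner_ray {r : ℝ} (hr : 0 < r) (ω φ ψ : ℝ → ℝ) (Φ Ψ : ℤ → ℝ)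
    (hΦ : ∀ i, Φ i = φ (r ^ i) * (ω (r ^ i) * ((1 - r) * r ^ i)))
    (hΨ : ∀ i, Ψ i = ψ (r ^ i) * (ω (r ^ i) * ((1 - r) * r ^ i)))
    (hsΦ : Summable Φ) (hsΨ : Summable Ψ) :
    HasSum (fun p : ℤ × ℤ => Φ p.1 * Ψ p.2 * ((1 + r) ^ 2 * halfSign p.1 p.2))
      (skewInner (r ^ 2) .ray ω φ ψ) := by
  obtain ⟨S, hS, hS'⟩ := hasSum_half_kernel halfSign (fun l : ℤ => 2 * l)
    (fun p : ℤ × ℕ => 2 * (p.1 + p.2) + 1) (by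
      rintro ⟨l, m⟩ ⟨l', m'⟩ h
      simp only [Prod.mk.injEq] at h ⊢
      omega)
    (fun p => halfSign_odd_even (by omega)) (fun p => halfSign_even_odd (by omega)) (by
      intro x y h1 h2
      unfold halfSign
      rw [if_neg, if_neg]
      · rintro ⟨m, n, rfl, rfl, h⟩
        refine h2 (n, (m - n).toNat) ⟨?_, rfl⟩
        simp only
        omega
      · rintro ⟨m, n, rfl, rfl, h⟩
        refine h1 (n, (m - n).toNat) ⟨?_, rfl⟩
        simp only
        omega) Φ Ψ hsΦ hsΨ
  have hval : skewInner (r ^ 2) .ray ω φ ψ = (1 + r) ^ 2 * S := by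
    rw [← hS'.tsum_eq, ← tsum_mul_left]
    simp only [skewInner, jacksonRay, jackson, Real.sqrt_sq hr.le]
    refine tsum_congr fun l => ?_
    simp only [zero_mul, mul_zero, tsum_zero, sub_zero]
    rw [← tsum_mul_left, ← tsum_mul_left]
    refine tsum_congr fun m => ?_
    have hy : (r ^ 2) ^ l = r ^ (2 * l) := by
      rw [zpow_mul]
      norm_cast
    have hx : r * (r ^ 2) ^ l * (r ^ 2) ^ m = r ^ (2 * (l + m) + 1) := by
      rw [zpow_add₀ hr.ne', mul_add, zpow_add₀ hr.ne', hy, zpow_one, ← pow_mul]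
      have : r ^ (2 * (m : ℤ)) = r ^ (2 * m) := by norm_cast
      rw [this]
      ring
    rw [hx, hy, hΦ, hΦ, hΨ, hΨ]
    ring
  rw [hval]
  refine (congrArg (fun F => HasSum F _) (funext fun p => ?_)).mp (hS.mul_left ((1 + r) ^ 2))
  ring

theorem hasSum_half_kernel_nat (Φ Ψ : ℕ → ℝ) (hΦ : Summable Φ) (hΨ : Summable Ψ) :
    ∃ S, HasSum (fun p : ℕ × ℕ => Φ p.1 * Ψ p.2 * halfSign p.1 p.2) S ∧
      HasSum (fun l => ∑' m, (Φ (2 * (l + m) + 1) * Ψ (2 * l) - Ψ (2 * (l + m) + 1) * Φ (2 * l)))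
        S := by
  refine hasSum_half_kernel (fun i j : ℕ => halfSign i j) (fun l : ℕ => 2 * l)
    (fun p : ℕ × ℕ => 2 * (p.1 + p.2) + 1) ?_ ?_ ?_ ?_ Φ Ψ hΦ hΨ
  · rintro ⟨l, m⟩ ⟨l', m'⟩ h
    simp only [Prod.mk.injEq] at h ⊢
    omega
  · intro p
    push_cast
    exact halfSign_odd_even (by omega)
  · intro p
    push_cast
    exact halfSign_even_odd (by omega)
  · intro x y h1 h2
    unfold halfSign
    rw [if_neg, if_neg]
    · rintro ⟨m, n, hx, hy, h⟩
      refine h2 (n.toNat, (m - n).toNat) ⟨?_, ?_⟩ <;> simp only <;> omega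
    · rintro ⟨m, n, hx, hy, h⟩
      refine h1 (n.toNat, (m - n).toNat) ⟨?_, ?_⟩ <;> simp only <;> omega

theorem hasSum_even_kernel (Φ Ψ : ℕ → ℝ) (hΦ : Summable Φ) (hΨ : Summable Ψ) :
    HasSum (fun p : ℕ × ℕ => Φ p.1 * Ψ p.2 * (if Even p.1 ∧ Even p.2 then 1 else 0))
      ((∑' m, Φ (2 * m)) * ∑' m, Ψ (2 * m)) := by
  have h2 : Function.Injective fun m : ℕ => 2 * m := fun m m' h => by
    simpa using h
  have hinj : Function.Injective fun p : ℕ × ℕ => (2 * p.1, 2 * p.2) := h2.prodMap h2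
  have h3 := hΦ.comp_injective h2
  have h4 := hΨ.comp_injective h2
  rw [← hinj.hasSum_iff]
  · have h5 := HasSum.mul h3.hasSum h4.hasSum (summable_mul_prod h3 h4)
    refine (congrArg (fun F => HasSum F _) (funext fun p => ?_)).mp h5
    simp
  · rintro ⟨x, y⟩ hp
    rw [if_neg, mul_zero]
    rintro ⟨⟨m, rfl⟩, m', rfl⟩
    exact hp ⟨(m, m'), by simp [two_mul]⟩

/-- The inner integral from `a` is the one from `0` to `r y` minus the one from `0` to `a`. The
first part gives the half kernel on each branch. The second does not depend on `y`, so it gives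
products of sums over even exponents: these couple the two branches. -/
theorem hasSum_skewInner_interval {r : ℝ} (hr : 0 < r) (a b : ℝ) (ω φ ψ : ℝ → ℝ)
    (Φa Ψa Φb Ψb : ℕ → ℝ)
    (hΦa : ∀ i, Φa i = φ (a * r ^ i) * (ω (a * r ^ i) * -((1 - r) * (a * r ^ i))))
    (hΨa : ∀ i, Ψa i = ψ (a * r ^ i) * (ω (a * r ^ i) * -((1 - r) * (a * r ^ i))))
    (hΦb : ∀ i, Φb i = φ (b * r ^ i) * (ω (b * r ^ i) * ((1 - r) * (b * r ^ i))))
    (hΨb : ∀ i, Ψb i = ψ (b * r ^ i) * (ω (b * r ^ i) * ((1 - r) * (b * r ^ i))))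
    (hsΦa : Summable Φa) (hsΨa : Summable Ψa) (hsΦb : Summable Φb) (hsΨb : Summable Ψb) :
    HasSum (fun p : (ℕ ⊕ ℕ) × (ℕ ⊕ ℕ) => Sum.elim Φb Φa p.1 * Sum.elim Ψb Ψa p.2 *
      skewKer (r ^ 2) (.interval a b) p.1 p.2)
      (skewInner (r ^ 2) (.interval a b) ω φ ψ) := by
  obtain ⟨Sb, hSb, hSb'⟩ := hasSum_half_kernel_nat Φb Ψb hsΦb hsΨb
  obtain ⟨Sa, hSa, hSa'⟩ := hasSum_half_kernel_nat Φa Ψa hsΦa hsΨa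
  have hab := hasSum_even_kernel Φa Ψb hsΦa hsΨb
  have hba := hasSum_even_kernel Φb Ψa hsΦb hsΨa
  have h2 : Function.Injective fun m : ℕ => 2 * m := fun m m' h => by
    simpa using h
  have sΦa := hsΦa.comp_injective h2
  have sΨa := hsΨa.comp_injective h2
  have sΦb := hsΦb.comp_injective h2
  have sΨb := hsΨb.comp_injective h2
  simp only [Function.comp_def] at sΦa sΨa sΦb sΨb
  set αa := ∑' m, Φa (2 * m) with hαa
  set βa := ∑' m, Ψa (2 * m) with hβa
  set αb := ∑' m, Φb (2 * m) with hαb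
  set βb := ∑' m, Ψb (2 * m) with hβb
  -- The outer branch of `a` enters with a minus sign. Its product term vanishes by antisymmetry,
  -- but is kept to match the Jackson sums termwise.
  have hval : skewInner (r ^ 2) (.interval a b) ω φ ψ =
      (1 + r) ^ 2 * (Sb + (αa * βb - βa * αb)) - (1 + r) ^ 2 * (Sa - (αa * βa - βa * αa)) := by
    have hB := (hSb'.add ((sΨb.hasSum.mul_left αa).sub (sΦb.hasSum.mul_left βa))).mul_left
      ((1 + r) ^ 2)
    have hA := (hSa'.sub ((sΨa.hasSum.mul_left αa).sub (sΦa.hasSum.mul_left βa))).mul_left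
      ((1 + r) ^ 2)
    rw [← hβb, ← hαb] at hB
    rw [← hβa, ← hαa] at hA
    rw [← hB.tsum_eq, ← hA.tsum_eq]
    simp only [skewInner, jackson, Real.sqrt_sq hr.le]
    have hcross : ∀ c d : ℝ, αa * c - βa * d = ∑' m, (Φa (2 * m) * c - Ψa (2 * m) * d) := by
      intro c d
      rw [hαa, hβa, ← tsum_mul_right, ← tsum_mul_right,
        (sΦa.mul_right c).tsum_sub (sΨa.mul_right d)]
    congr 1
    · refine tsum_congr fun l => ?_
      rw [hcross, mul_sub, mul_add, ← tsum_mul_left, ← tsum_mul_left, ← tsum_mul_left,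
        ← tsum_mul_left, sub_eq_add_neg, ← tsum_neg]
      congr 1
      · refine tsum_congr fun m => ?_
        have hx : r * (b * (r ^ 2) ^ l) * (r ^ 2) ^ m = b * r ^ (2 * (l + m) + 1) := by ring
        have hy : b * (r ^ 2) ^ l = b * r ^ (2 * l) := by ring
        rw [hx, hy, hΦb, hΦb, hΨb, hΨb]
        ring
      · refine tsum_congr fun m => ?_
        have hx : a * (r ^ 2) ^ m = a * r ^ (2 * m) := by ring
        have hy : b * (r ^ 2) ^ l = b * r ^ (2 * l) := by ring
        rw [hx, hy, hΦa, hΨa, hΦb, hΨb]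
        ring
    · refine tsum_congr fun l => ?_
      rw [hcross, mul_sub, mul_sub, ← tsum_mul_left, ← tsum_mul_left, ← tsum_mul_left,
        ← tsum_mul_left]
      congr 1
      · refine tsum_congr fun m => ?_
        have hx : r * (a * (r ^ 2) ^ l) * (r ^ 2) ^ m = a * r ^ (2 * (l + m) + 1) := by ring
        have hy : a * (r ^ 2) ^ l = a * r ^ (2 * l) := by ring
        rw [hx, hy, hΦa, hΦa, hΨa, hΨa]
        ring
      · refine tsum_congr fun m => ?_
        have hx : a * (r ^ 2) ^ m = a * r ^ (2 * m) := by ring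
        have hy : a * (r ^ 2) ^ l = a * r ^ (2 * l) := by ring
        rw [hx, hy, hΦa, hΨa, hΦa, hΨa]
        ring
  have htot : skewInner (r ^ 2) (.interval a b) ω φ ψ =
      (1 + r) ^ 2 * Sb + -((1 + r) ^ 2) * (αb * βa) +
        ((1 + r) ^ 2 * (αa * βb) + -((1 + r) ^ 2) * Sa) := by
    rw [hval]
    ring
  rw [htot]
  refine hasSum_prod_sum_type ?_ ?_ ?_ ?_
  · refine (congrArg (fun F => HasSum F _) (funext fun p => ?_)).mp (hSb.mul_left ((1 + r) ^ 2))
    simp only [skewKer, Sum.elim_inl, Real.sqrt_sq hr.le]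
    ring
  · refine (congrArg (fun F => HasSum F _) (funext fun p => ?_)).mp (hba.mul_left (-((1 + r) ^ 2)))
    simp only [skewKer, Sum.elim_inl, Sum.elim_inr, Real.sqrt_sq hr.le]
    ring
  · refine (congrArg (fun F => HasSum F _) (funext fun p => ?_)).mp (hab.mul_left ((1 + r) ^ 2))
    simp only [skewKer, Sum.elim_inl, Sum.elim_inr, Real.sqrt_sq hr.le]
    ring
  · refine (congrArg (fun F => HasSum F _) (funext fun p => ?_)).mp (hSa.mul_left (-((1 + r) ^ 2)))
    simp only [skewKer, Sum.elim_inr, Real.sqrt_sq hr.le]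
    ring

/-- The skew inner product is the double sum of the skew kernel over the lattice. -/
theorem hasSum_skewInner {q : ℝ} (hq : 0 < q) (C : Contour) (ω φ ψ : ℝ → ℝ)
    (hφ : Summable fun x : C.Site => φ (point q C x) * (ω (point q C x) * mass q C x))
    (hψ : Summable fun x : C.Site => ψ (point q C x) * (ω (point q C x) * mass q C x)) :
    HasSum (fun p : C.Site × C.Site => φ (point q C p.1) * (ω (point q C p.1) * mass q C p.1) *
      (ψ (point q C p.2) * (ω (point q C p.2) * mass q C p.2)) * skewKer q C p.1 p.2)
      (skewInner q C ω φ ψ) := by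
  obtain ⟨r, hr, rfl⟩ : ∃ r : ℝ, 0 < r ∧ q = r ^ 2 := ⟨√q, Real.sqrt_pos.2 hq, (Real.sq_sqrt hq.le).symm⟩
  have hsq : √(r ^ 2) = r := Real.sqrt_sq hr.le
  rcases C with _ | ⟨a, b⟩
  · have := hasSum_skewInner_ray hr ω φ ψ _ _ (fun i => rfl) (fun i => rfl)
      (by simpa only [point, mass, hsq] using hφ) (by simpa only [point, mass, hsq] using hψ)
    simpa only [point, mass, skewKer, hsq] using this
  · have hφa := hφ.comp_injective (Sum.inr_injective (α := ℕ) (β := ℕ))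
    have hφb := hφ.comp_injective (Sum.inl_injective (α := ℕ) (β := ℕ))
    have hψa := hψ.comp_injective (Sum.inr_injective (α := ℕ) (β := ℕ))
    have hψb := hψ.comp_injective (Sum.inl_injective (α := ℕ) (β := ℕ))
    simp only [Function.comp_def, point, mass, hsq] at hφa hφb hψa hψb
    have := hasSum_skewInner_interval hr a b ω φ ψ _ _ _ _ (fun i => rfl) (fun i => rfl)
      (fun i => rfl) (fun i => rfl) hφa hψa hφb hψb
    refine (congrArg (fun F => HasSum F _) (funext fun p => ?_)).mp this
    obtain ⟨x | x, y | y⟩ := p <;> simp only [point, mass, hsq, Sum.elim_inl, Sum.elim_inr]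

/-! ### Correlation functions through skew orthogonal polynomials -/

/-- There are `n (2 n - 1)` factors, a number of the same parity as `n`. This is the sign between `∏
(z_i - z_j)` and the Vandermonde determinant. -/
theorem prod_Ioi_neg_one (n : ℕ) :
    ∏ i : Fin (2 * n), ∏ _j ∈ Finset.Ioi i, (-1 : ℝ) = (-1) ^ n := by
  have h : ∀ N : ℕ, ∏ i : Fin (N + 1), ∏ _j ∈ Finset.Ioi i, (-1 : ℝ) =
      (-1) ^ N * ∏ i : Fin N, ∏ _j ∈ Finset.Ioi i, (-1 : ℝ) := by
    intro N
    simp only [prod_const, Fin.card_Ioi, Fin.prod_univ_succ]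
    congr 1
    refine prod_congr rfl fun i _ => ?_
    congr 1
    simp
    omega
  induction n with
  | zero => simp
  | succ n ih =>
    rw [show 2 * (n + 1) = 2 * n + 1 + 1 by ring, h, h, ih, pow_succ (-1 : ℝ) (2 * n), pow_mul,
      pow_succ (-1 : ℝ) n]
    norm_num

/-- The evaluation of a polynomial at the point with a given label. -/
noncomputable def evalAt (q : ℝ) (C : Contour) (P : Polynomial ℝ) (x : C.Site) : ℝ :=
  P.eval (point q C x)

/-- The weight of the integrals at the point with a given label. -/
noncomputable def siteWeight (q : ℝ) (C : Contour) (ω : ℝ → ℝ) (x : C.Site) : ℝ :=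
  ω (point q C x) * mass q C x

section

variable {q : ℝ} {C : Contour} {ω : ℝ → ℝ} {n : ℕ}

theorem summable_evalAt (hmom : ∀ i < 2 * n, Summable fun p : C.Site =>
      point q C p ^ i * ω (point q C p) * mass q C p) {P : Polynomial ℝ}
    (hP : P.natDegree < 2 * n) :
    Summable fun x => evalAt q C P x * siteWeight q C ω x := by
  have h : ∀ x, evalAt q C P x * siteWeight q C ω x = ∑ i ∈ range (P.natDegree + 1),
      P.coeff i * (point q C x ^ i * ω (point q C x) * mass q C x) := by
    intro x
    rw [evalAt, siteWeight, Polynomial.eval_eq_sum_range, sum_mul]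
    refine sum_congr rfl fun i _ => ?_
    ring
  simp only [h]
  refine summable_sum fun i hi => (hmom i ?_).mul_left _
  have := mem_range.1 hi
  omega

theorem summable_skewKer_mul {f : C.Site → ℝ} (hf : Summable f) (x : C.Site) :
    Summable fun z => skewKer q C z x * f z :=
  Summable.of_norm_bounded (hf.norm.mul_left ((1 + √q) ^ 2)) fun z => by
    rw [norm_mul]
    exact mul_le_mul_of_nonneg_right (abs_skewKer_le q C z x) (norm_nonneg _)

theorem hasSum_skewOp {P : Polynomial ℝ}
    (hP : Summable fun x => evalAt q C P x * siteWeight q C ω x) (x : C.Site) :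
    HasSum (fun z => skewKer q C z x * (evalAt q C P z * siteWeight q C ω z))
      (skewOp q C ω (evalAt q C P) x) := by
  have h := (summable_skewKer_mul (q := q) hP x).hasSum
  have he : skewOp q C ω (evalAt q C P) x =
      ∑' z, skewKer q C z x * (evalAt q C P z * siteWeight q C ω z) :=
    tsum_congr fun z => by
      rw [siteWeight]
      ring
  rw [he]
  exact h

theorem skewOp_sum {P R : ℕ → Polynomial ℝ}
    (hP : ∀ i < n, Summable fun x => evalAt q C (P i) x * siteWeight q C ω x)
    (hR : ∀ i < n, Summable fun x => evalAt q C (R i) x * siteWeight q C ω x) (c d : ℕ → ℝ)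
    (x : C.Site) :
    skewOp q C ω (fun z => ∑ i ∈ range n, (c i * evalAt q C (P i) z - d i * evalAt q C (R i) z)) x =
      ∑ i ∈ range n, (c i * skewOp q C ω (evalAt q C (P i)) x -
        d i * skewOp q C ω (evalAt q C (R i)) x) := by
  have h : HasSum (fun z => ∑ i ∈ range n,
      (c i * (skewKer q C z x * (evalAt q C (P i) z * siteWeight q C ω z)) -
        d i * (skewKer q C z x * (evalAt q C (R i) z * siteWeight q C ω z)))) _ :=
    hasSum_sum fun i hi =>
      ((hasSum_skewOp (hP i (mem_range.1 hi)) x).mul_left (c i)).sub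
        ((hasSum_skewOp (hR i (mem_range.1 hi)) x).mul_left (d i))
  rw [← h.tsum_eq]
  refine tsum_congr fun z => ?_
  rw [mul_sum, sum_mul, sum_mul]
  refine sum_congr rfl fun i _ => ?_
  rw [siteWeight]
  ring

variable {Q : ℕ → Polynomial ℝ} {u : ℕ → ℝ}

theorem kerJ_eq
    (hs : ∀ l < 2 * n, Summable fun x => evalAt q C (Q l) x * siteWeight q C ω x) (x y : C.Site) :
    kerJ q C ω Q u n x y = ∑ i ∈ range n,
      ((1 / u i * evalAt q C (Q (2 * i + 1)) y) * skewOp q C ω (evalAt q C (Q (2 * i))) x -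
        (1 / u i * evalAt q C (Q (2 * i)) y) * skewOp q C ω (evalAt q C (Q (2 * i + 1))) x) := by
  rw [← skewOp_sum (P := fun i => Q (2 * i)) (R := fun i => Q (2 * i + 1))
    (fun i hi => hs _ (by omega)) (fun i hi => hs _ (by omega))
    (fun i => 1 / u i * evalAt q C (Q (2 * i + 1)) y) (fun i => 1 / u i * evalAt q C (Q (2 * i)) y)]
  unfold kerJ
  congr 1
  funext z
  refine sum_congr rfl fun i _ => ?_
  simp only [evalAt]
  ring

/-- As for `kerJ_eq`, the integral operators pass through the finite sum, so the kernel becomes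
bilinear in the transforms `s Q_l`. -/
theorem kerI_eq
    (hs : ∀ l < 2 * n, Summable fun x => evalAt q C (Q l) x * siteWeight q C ω x) (x y : C.Site) :
    kerI q C ω Q u n x y = skewKer q C x y - ∑ i ∈ range n,
      ((1 / u i * skewOp q C ω (evalAt q C (Q (2 * i + 1))) y) *
          skewOp q C ω (evalAt q C (Q (2 * i))) x -
        (1 / u i * skewOp q C ω (evalAt q C (Q (2 * i))) y) *
          skewOp q C ω (evalAt q C (Q (2 * i + 1))) x) := by
  rw [← skewOp_sum (P := fun i => Q (2 * i)) (R := fun i => Q (2 * i + 1))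
    (fun i hi => hs _ (by omega)) (fun i hi => hs _ (by omega))
    (fun i => 1 / u i * skewOp q C ω (evalAt q C (Q (2 * i + 1))) y)
    (fun i => 1 / u i * skewOp q C ω (evalAt q C (Q (2 * i))) y)]
  unfold kerI
  congr 2
  funext z
  have := skewOp_sum (P := fun i => Q (2 * i + 1)) (R := fun i => Q (2 * i)) (q := q) (C := C)
    (ω := ω) (n := n)
    (fun i hi => hs _ (by omega)) (fun i hi => hs _ (by omega))
    (fun i => 1 / u i * evalAt q C (Q (2 * i)) z) (fun i => 1 / u i * evalAt q C (Q (2 * i + 1)) z) y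
  refine Eq.trans ?_ (this.trans ?_)
  · congr 1
    funext z'
    refine sum_congr rfl fun i _ => ?_
    simp only [evalAt]
    ring
  · refine sum_congr rfl fun i _ => ?_
    ring

theorem kerMat_skew
    (hs : ∀ l < 2 * n, Summable fun x => evalAt q C (Q l) x * siteWeight q C ω x) (x y : C.Site) :
    kerMat q C ω Q u n y x = -(kerMat q C ω Q u n x y).transpose := by
  have hK : kerK q C Q u n y x = -kerK q C Q u n x y := by
    unfold kerK
    rw [← sum_neg_distrib]
    refine sum_congr rfl fun i _ => ?_
    ring
  have hI : kerI q C ω Q u n y x = -kerI q C ω Q u n x y := by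
    rw [kerI_eq hs, kerI_eq hs, skewKer_skew, neg_sub', ← sum_neg_distrib]
    congr 1
    refine sum_congr rfl fun i _ => ?_
    ring
  ext i j
  fin_cases i <;> fin_cases j <;> simp [kerMat, hK, hI]

/-- The matrix of the values and of the transforms of the polynomials at fixed points. -/
noncomputable def fixedRows (q : ℝ) (C : Contour) (ω : ℝ → ℝ) (Q : ℕ → Polynomial ℝ) (n : ℕ) {k : ℕ}
    (z : Fin k → C.Site) : Matrix (Fin k × Fin 2) (Fin (2 * n)) ℝ :=
  Matrix.of fun p r => if p.2 = 0 then evalAt q C (Q r) (z p.1)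
    else -skewOp q C ω (evalAt q C (Q r)) (z p.1)

/-- The skew kernel on the second copies of fixed points. -/
noncomputable def fixedForm (q : ℝ) (C : Contour) {k : ℕ} (z : Fin k → C.Site) :
    Matrix (Fin k × Fin 2) (Fin k × Fin 2) ℝ :=
  Matrix.of fun p p' => if p.2 = 0 then 0 else if p'.2 = 0 then 0 else skewKer q C (z p.1) (z p'.1)

/-- De Bruijn's formula applied to the rows `Q_r`: the Gram matrix is the skew inner product, and
grouping the indices as `2 i, 2 i + 1` makes it `sympl u`. -/
theorem tsum_density (hq : 0 < q)
    (hs : ∀ l < 2 * n, Summable fun x => evalAt q C (Q l) x * siteWeight q C ω x)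
    (hQ : IsSkewOrthogonal q C ω n Q u) (k : ℕ) (hk : k ≤ 2 * n) (z : Fin k → C.Site) :
    ∑' w : Fin (2 * n - k) → C.Site,
      density q C ω n (Fin.append z w ∘ Fin.cast (Nat.add_sub_of_le hk).symm) *
        ∏ i, mass q C (w i) =
    (-1) ^ n * (∏ l, ω (point q C (z l))) * ((2 * n - k).factorial * ((-1) ^ k *
      pf (sumPairs (Equiv.refl (Fin k × Fin 2)) (Equiv.refl (Fin n × Fin 2)))
        (Matrix.fromBlocks (fixedForm q C z) ((fixedRows q C ω Q n z).submatrix id (finPairs n))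
          (-((fixedRows q C ω Q n z).submatrix id (finPairs n)).transpose)
          (sympl fun i : Fin n => u i)))) := by
  set D : Matrix (Fin (2 * n)) (Fin (2 * n)) ℝ := Matrix.of fun r r' =>
    skewInner q C ω (fun x => (Q r).eval x) (fun x => (Q r').eval x) with hDdef
  have hD : ∀ r r' : Fin (2 * n), HasSum (fun p : C.Site × C.Site =>
      evalAt q C (Q r) p.1 * siteWeight q C ω p.1 * (evalAt q C (Q r') p.2 * siteWeight q C ω p.2) *
        skewKer q C p.1 p.2) (D r r') := fun r r' =>
    hasSum_skewInner hq C ω _ _ (hs r r.2) (hs r' r'.2)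
  have hDskew : ∀ r r', D r r' = -D r' r := by
    intro r r'
    refine (hD r r').unique ?_
    have h := (hD r' r).neg
    rw [← (Equiv.prodComm C.Site C.Site).hasSum_iff] at h
    refine (congrArg (fun F => HasSum F _) (funext fun p => ?_)).mp h
    simp only [Function.comp_apply, Equiv.prodComm_apply, Prod.fst_swap, Prod.snd_swap]
    rw [skewKer_skew]
    ring
  have hDs : D.submatrix (finPairs n) (finPairs n) = sympl fun i : Fin n => u i := by
    have heo : ∀ i j : Fin n, D (finPairs n (i, 0)) (finPairs n (j, 1)) =
        if i = j then u i else 0 := by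
      intro i j
      simp only [Fin.ext_iff]
      exact hQ.even_odd i i.2 j j.2
    ext ⟨i, b⟩ ⟨j, c⟩
    fin_cases b <;> fin_cases c
    · refine (hQ.even_even i i.2 j j.2).trans ?_
      simp [sympl]
    · refine (heo i j).trans ?_
      simp [sympl]
    · refine (hDskew _ _).trans ?_
      refine (congrArg Neg.neg (heo j i)).trans ?_
      by_cases h : i = j
      · simp [sympl, h]
      · simp [sympl, h, Ne.symm h]
    · refine (hQ.odd_odd i i.2 j j.2).trans ?_
      simp [sympl]
  -- The sign appears because `skewOp` integrates over the first argument of `s`, whereas here the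
  -- fixed point is the first argument.
  have hb : ∀ (i : Fin k) (r : Fin (2 * n)),
      HasSum (fun x => skewKer q C (z i) x * (evalAt q C (Q r) x * siteWeight q C ω x))
        (-skewOp q C ω (evalAt q C (Q r)) (z i)) := by
    intro i r
    refine (congrArg (fun F => HasSum F _) (funext fun x => ?_)).mp
      (hasSum_skewOp (hs r r.2) (z i)).neg
    rw [skewKer_skew q C (z i)]
    ring
  have key := tsum_pfaffian_mul_det (skewKer q C) z
    (fun r x => evalAt q C (Q r) x * siteWeight q C ω x) (fun r x => evalAt q C (Q r) x)
    (siteWeight q C ω) (fun _ _ => rfl) _ hb (skewKer_skew q C) hk D hD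
  have hpf : pf (sumPairs (Equiv.refl (Fin k × Fin 2)) (finPairs n))
      (Matrix.fromBlocks (fixedForm q C z) (fixedRows q C ω Q n z)
        (-(fixedRows q C ω Q n z).transpose) D) =
      pf (sumPairs (Equiv.refl (Fin k × Fin 2)) (Equiv.refl (Fin n × Fin 2)))
        (Matrix.fromBlocks (fixedForm q C z) ((fixedRows q C ω Q n z).submatrix id (finPairs n))
          (-((fixedRows q C ω Q n z).submatrix id (finPairs n)).transpose)
          (sympl fun i : Fin n => u i)) := by
    have he : sumPairs (Equiv.refl (Fin k × Fin 2)) (finPairs n) =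
        (sumPairs (Equiv.refl (Fin k × Fin 2)) (Equiv.refl (Fin n × Fin 2))).trans
          ((Equiv.refl _).sumCongr (finPairs n)) := by
      apply Equiv.ext
      rintro ⟨i | i, b⟩ <;> rfl
    rw [he, ← pf_submatrix_equiv, ← hDs]
    congr 1
    ext (p | p) (p' | p') <;> rfl
  rw [← hpf]
  refine Eq.trans ?_ ((congrArg (fun t => (-1) ^ n * (∏ l, ω (point q C (z l))) * t) key))
  rw [← tsum_mul_left]
  refine tsum_congr fun w => ?_
  set v := Fin.append z w ∘ Fin.cast (Nat.add_sub_of_le hk).symm with hv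
  have hdet : (Matrix.of fun (r l : Fin (2 * n)) => evalAt q C (Q r) (v l)).det =
      (-1) ^ n * ∏ i, ∏ j ∈ Finset.Ioi i, (point q C (v i) - point q C (v j)) := by
    have h1 := Matrix.det_eval_matrixOfPolynomials_eq_det_vandermonde (fun l => point q C (v l))
      (fun r : Fin (2 * n) => Q r) (fun r => hQ.natDegree_eq r r.2) (fun r => hQ.monic r r.2)
    rw [← Matrix.det_transpose]
    refine h1.symm.trans ?_
    rw [Matrix.det_vandermonde, ← prod_Ioi_neg_one, ← prod_mul_distrib]
    refine prod_congr rfl fun i _ => ?_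
    rw [← prod_mul_distrib]
    refine prod_congr rfl fun j _ => ?_
    ring
  have hω : ∏ l, ω (point q C (v l)) =
      (∏ l, ω (point q C (z l))) * ∏ j, ω (point q C (w j)) := by
    refine (Equiv.prod_comp (finCongr (Nat.add_sub_of_le hk).symm)
      (fun l => ω (point q C (Fin.append z w l)))).trans ?_
    rw [Fin.prod_univ_add]
    simp
  have hsq : ((-1 : ℝ) ^ n) * (-1) ^ n = 1 := by rw [← mul_pow]; simp
  rw [hdet]
  simp only [density, hω, siteWeight, prod_mul_distrib]
  linear_combination (-(pfaffian n (Matrix.of fun i j => skewKer q C (v i) (v j)) *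
    (∏ i, ∏ j ∈ Finset.Ioi i, (point q C (v i) - point q C (v j))) *
    ((∏ l, ω (point q C (z l))) * ∏ j, ω (point q C (w j))) * ∏ i, mass q C (w i))) * hsq

/-- The case `k = 0` of `tsum_density`, where only the symplectic block is left. -/
theorem partitionFunction_eq (hq : 0 < q)
    (hs : ∀ l < 2 * n, Summable fun x => evalAt q C (Q l) x * siteWeight q C ω x)
    (hQ : IsSkewOrthogonal q C ω n Q u) :
    partitionFunction q C ω n = (-1) ^ n * ∏ i : Fin n, u i := by
  have h := tsum_density hq hs hQ 0 (Nat.zero_le _) Fin.elim0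
  have hpf := pf_fromBlocks_sympl (Equiv.refl (Fin 0 × Fin 2)) (fixedForm q C Fin.elim0)
    (fun p => p.1.elim0) (fun i : Fin n => u i)
  have hM : Matrix.fromBlocks (fixedForm q C Fin.elim0)
      ((fixedRows q C ω Q n Fin.elim0).submatrix id (finPairs n))
      (-((fixedRows q C ω Q n Fin.elim0).submatrix id (finPairs n)).transpose)
      (sympl fun i : Fin n => u i) =
      Matrix.fromBlocks (fixedForm q C Fin.elim0) 0 0 (sympl fun i : Fin n => u i) := by
    ext (p | p) (p' | p')
    · rfl
    · exact p.1.elim0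
    · exact p'.1.elim0
    · rfl
  have h1 : pf (Equiv.refl (Fin 0 × Fin 2)) (fixedForm q C Fin.elim0) = 1 := by
    simp [pf]
  rw [hM, hpf, h1] at h
  have hw : ∀ w : Fin (2 * n) → C.Site, Fin.append Fin.elim0 w ∘
      Fin.cast (Nat.add_sub_of_le (Nat.zero_le (2 * n))).symm = w := by
    intro w
    funext l
    have h3 : Fin.cast (Nat.add_sub_of_le (Nat.zero_le (2 * n))) (Fin.natAdd 0 l) = l :=
      Fin.ext (Nat.zero_add _)
    have h4 := append_cast_natAdd (Nat.zero_le (2 * n)) Fin.elim0 w l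
    rw [h3] at h4
    exact h4
  have h2 : ∑' w : Fin (2 * n) → C.Site, density q C ω n w * ∏ i, mass q C (w i) =
      ∑' w : Fin (2 * n - 0) → C.Site,
      density q C ω n (Fin.append Fin.elim0 w ∘ Fin.cast (Nat.add_sub_of_le (Nat.zero_le _)).symm) *
        ∏ i, mass q C (w i) := by
    refine tsum_congr fun w => ?_
    rw [hw w]
    rfl
  rw [partitionFunction, h2, h]
  have := Nat.factorial_ne_zero (2 * n)
  simp only [univ_eq_empty, prod_empty, pow_zero, Nat.sub_zero, mul_one, one_mul]
  field_simp

/-- The inverse of `sympl u` combines the rows `2 l` and `2 l + 1` with coefficient `-1 / u l`,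
which reproduces the bilinear expansions of the kernels `K`, `J` and `I`, each with the opposite
sign. -/
theorem schur_complement_eq
    (hs : ∀ l < 2 * n, Summable fun x => evalAt q C (Q l) x * siteWeight q C ω x) {k : ℕ}
    (z : Fin k → C.Site) :
    fixedForm q C z + (fixedRows q C ω Q n z).submatrix id (finPairs n) *
        sympl (fun i : Fin n => -(u i)⁻¹) *
        ((fixedRows q C ω Q n z).submatrix id (finPairs n)).transpose =
      (-1 : ℝ) • (blockMatrix fun i j => kerMat q C ω Q u n (z i) (z j)).submatrix
        (finPairs k) (finPairs k) := by
  have hblock : ∀ p p' : Fin k × Fin 2,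
      (blockMatrix fun i j => kerMat q C ω Q u n (z i) (z j)) (finPairs k p) (finPairs k p') =
        kerMat q C ω Q u n (z p.1) (z p'.1) p.2 p'.2 := by
    intro p p'
    change kerMat q C ω Q u n (z ((finPairs k).symm (finPairs k p)).1)
      (z ((finPairs k).symm (finPairs k p')).1) ((finPairs k).symm (finPairs k p)).2
      ((finPairs k).symm (finPairs k p')).2 = _
    rw [Equiv.symm_apply_apply, Equiv.symm_apply_apply]
  have hrow0 : ∀ i j, (fixedRows q C ω Q n z).submatrix id (finPairs n) (i, 0) (j, 0) =
      evalAt q C (Q (2 * j)) (z i) := fun i j => rfl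
  have hrow1 : ∀ i j, (fixedRows q C ω Q n z).submatrix id (finPairs n) (i, 0) (j, 1) =
      evalAt q C (Q (2 * j + 1)) (z i) := fun i j => rfl
  have hrow2 : ∀ i j, (fixedRows q C ω Q n z).submatrix id (finPairs n) (i, 1) (j, 0) =
      -skewOp q C ω (evalAt q C (Q (2 * j))) (z i) := fun i j => rfl
  have hrow3 : ∀ i j, (fixedRows q C ω Q n z).submatrix id (finPairs n) (i, 1) (j, 1) =
      -skewOp q C ω (evalAt q C (Q (2 * j + 1))) (z i) := fun i j => rfl
  ext ⟨i, b⟩ ⟨j, c⟩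
  rw [Matrix.add_apply, mul_sympl_mul_transpose, Matrix.smul_apply, Matrix.submatrix_apply, hblock,
    smul_eq_mul]
  fin_cases b <;> fin_cases c <;> simp only [Fin.zero_eta, Fin.mk_one, hrow0, hrow1, hrow2, hrow3]
  · have h1 : kerMat q C ω Q u n (z i) (z j) 0 0 = kerK q C Q u n (z i) (z j) := rfl
    have h2 : fixedForm q C z (i, 0) (j, 0) = 0 := rfl
    rw [h1, h2, kerK, Finset.sum_range, zero_add, mul_sum]
    refine sum_congr rfl fun l _ => ?_
    simp only [evalAt]
    ring
  · have h1 : kerMat q C ω Q u n (z i) (z j) 0 1 = kerJ q C ω Q u n (z j) (z i) := rfl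
    have h2 : fixedForm q C z (i, 0) (j, 1) = 0 := rfl
    rw [h1, h2, kerJ_eq hs, Finset.sum_range, zero_add, mul_sum]
    refine sum_congr rfl fun l _ => ?_
    ring
  · have h1 : kerMat q C ω Q u n (z i) (z j) 1 0 = -kerJ q C ω Q u n (z i) (z j) := rfl
    have h2 : fixedForm q C z (i, 1) (j, 0) = 0 := rfl
    rw [h1, h2, kerJ_eq hs, Finset.sum_range, zero_add, ← sum_neg_distrib, mul_sum]
    refine sum_congr rfl fun l _ => ?_
    ring
  · have h1 : kerMat q C ω Q u n (z i) (z j) 1 1 = -kerI q C ω Q u n (z i) (z j) := rfl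
    have h2 : fixedForm q C z (i, 1) (j, 1) = skewKer q C (z i) (z j) := rfl
    rw [h1, h2, kerI_eq hs, Finset.sum_range, neg_mul_neg, one_mul, sub_eq_add_neg,
      ← sum_neg_distrib]
    congr 1
    refine sum_congr rfl fun l _ => ?_
    ring

end

end QOrth

theorem mainTheorem5 (q : ℝ) (hq0 : 0 < q) (hq1 : q < 1) (C : QOrth.Contour) (ω : ℝ → ℝ)
    (n : ℕ)
    (hmom : ∀ i < 2 * n, Summable fun p : C.Site =>
      QOrth.point q C p ^ i * ω (QOrth.point q C p) * QOrth.mass q C p)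
    (hτ : QOrth.partitionFunction q C ω n ≠ 0)
    (Q : ℕ → Polynomial ℝ) (u : ℕ → ℝ) (hQ : QOrth.IsSkewOrthogonal q C ω n Q u) :
    (∀ x y : C.Site,
      QOrth.kerMat q C ω Q u n y x = -(QOrth.kerMat q C ω Q u n x y).transpose) ∧
    ∀ (k : ℕ) (hk : k ≤ 2 * n) (z : Fin k → C.Site),
      QOrth.correlation q C ω n k hk z =
        QOrth.pfaffian k
            (QOrth.blockMatrix fun i j => QOrth.kerMat q C ω Q u n (z i) (z j)) *
          ∏ l, ω (QOrth.point q C (z l)) := by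
  have hs : ∀ l < 2 * n, Summable fun x => QOrth.evalAt q C (Q l) x * QOrth.siteWeight q C ω x :=
    fun l hl => QOrth.summable_evalAt hmom (by rwa [hQ.natDegree_eq l hl])
  refine ⟨QOrth.kerMat_skew hs, fun k hk z => ?_⟩
  have hτe := QOrth.partitionFunction_eq hq0 hs hQ
  rw [hτe] at hτ
  have hprod : (∏ i : Fin n, u i) ≠ 0 := right_ne_zero_of_mul hτ
  have hu : ∀ i : Fin n, u i ≠ 0 := fun i => Finset.prod_ne_zero_iff.1 hprod i (Finset.mem_univ i)
  have hform : ∀ p p', QOrth.fixedForm q C z p p' = -QOrth.fixedForm q C z p' p := by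
    intro p p'
    simp only [QOrth.fixedForm, Matrix.of_apply]
    rw [QOrth.skewKer_skew q C (z p.1)]
    split_ifs <;> simp
  rw [QOrth.correlation, hτe, QOrth.tsum_density hq0 hs hQ k hk z,
    QOrth.pf_schur (Equiv.refl _) _ hform _ _ hu, QOrth.schur_complement_eq hs, QOrth.pf_smul,
    QOrth.pf_submatrix_equiv, QOrth.pfaffian_eq_pf, Fintype.card_fin]
  have hfac : ((2 * n - k).factorial : ℝ) ≠ 0 := by exact_mod_cast Nat.factorial_ne_zero _
  have hsq : ((-1 : ℝ) ^ k) * (-1) ^ k = 1 := by rw [← mul_pow]; simp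
  have hn : ((-1 : ℝ) ^ n) ≠ 0 := pow_ne_zero _ (by norm_num)
  rw [Equiv.refl_trans]
  generalize QOrth.pf (QOrth.finPairs k) _ = P
  rw [one_div, inv_mul_eq_iff_eq_mul₀ (mul_ne_zero hfac hτ)]
  -- The two factors `(-1) ^ k`, one from interchanging fixed rows and one from the Pfaffian of
  -- minus the kernel, cancel.
  linear_combination ((-1) ^ n * (∏ l, ω (QOrth.point q C (z l))) * (2 * n - k).factorial *
    (∏ i : Fin n, u i) * P) * hsq
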